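/- Let $b>0$ and let $\theta:[0,b]\to[0,\infty)$ be a smooth function (smooth up to the endpoints) such that $\theta^{-1}\{0\}=\{0,b\}$ and $\theta^{-1}\{\pi/2\}=\varnothing$. Then the metric $$g = dx^2+\sin^2\theta(x)\,dy^2+\cos^2\theta(x)\,dz^2,\qquad 0<x<b,$$ defines a smooth metric on $\mathbb S^2\times\mathbb R$ if and only if $\theta'(0)=-\theta'(b)=1$ and $\theta^{(2k)}(0)=\theta^{(2k)}(b)=0$ for every integer $k\ge 0$ (one-sided derivatives at the endpoints). Here "$g$ defines a smooth metric on $\mathbb S^2\times\mathbb R$" means the following: there are a continuous function $\alpha:[0,b]\to[0,\pi]$ with $\alpha(0)=0$, $\alpha(b)=\pi$, smooth with $\alpha'>0$ on $(0,b)$, and a $C^\infty$ Riemannian metric on all of $\mathbb S^2\times\mathbb R$ (including the two lines over the poles of $\mathbb S^2$, which correspond to $x=0$ and $x=b$), whose pullback under the polar parametrization $$(x,y,z)\mapsto\big((\sin\alpha(x)\cos y,\ \sin\alpha(x)\sin y,\ \cos\alpha(x)),\,z\big),\qquad x\in(0,b),\ y\in\mathbb R,\ z\in\mathbb R,$$ is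 $g$; so $y$ is an angle of period $2\pi$ on $\mathbb S^1$, and $x$ runs along the meridians from pole to pole. -/

import Mathlib

open Real Set
open scoped Manifold ContDiff

noncomputable section

/-- The unit sphere `S²` of Euclidean 3-space, with Mathlib's smooth structure. -/
abbrev S2 : Type := Metric.sphere (0 : EuclideanSpace ℝ (Fin 3)) 1

/-- The model with corners of the boundaryless 3-manifold `S² × ℝ`. -/
abbrev modelS2R :
    ModelWithCorners ℝ (EuclideanSpace ℝ (Fin 2) × ℝ)
      (ModelProd (EuclideanSpace ℝ (Fin 2)) ℝ) :=
  (𝓡 2).prod 𝓘(ℝ, ℝ)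

/-- A smooth (`C^∞`) Riemannian metric on the manifold `S² × ℝ`. -/
abbrev SmoothMetricS2R : Type :=
  Bundle.ContMDiffRiemannianMetric modelS2R ∞ (EuclideanSpace ℝ (Fin 2) × ℝ)
    (fun p : S2 × ℝ => TangentSpace modelS2R p)

/-- The point of `S²` with colatitude `r` (angle from the north pole) and longitude `y`. -/
def spherePoint (r y : ℝ) : S2 :=
  ⟨!₂[sin r * cos y, sin r * sin y, cos r], by
    rw [mem_sphere_zero_iff_norm, EuclideanSpace.norm_eq, Real.sqrt_eq_one]
    simp only [Real.norm_eq_abs, sq_abs, Fin.sum_univ_three]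
    simp
    nlinarith [sin_sq_add_cos_sq r, sin_sq_add_cos_sq y]⟩

/-- `α` is an admissible colatitude on `[0, b]`: a continuous function that runs from `0`
(north pole) to `π` (south pole) and is smooth with positive derivative on `(0, b)`. -/
structure IsColatitude (b : ℝ) (α : ℝ → ℝ) : Prop where
  continuousOn : ContinuousOn α (Icc 0 b)
  contDiffOn : ContDiffOn ℝ ∞ α (Ioo 0 b)
  deriv_pos : ∀ x ∈ Ioo 0 b, 0 < deriv α x
  left : α 0 = 0
  right : α b = π

/-- The parametrization of `S² × ℝ` by `(x, y, z)`, in which `x` determines the colatitude `α x`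
on the sphere, `y` is the longitude and `z` is the coordinate of the factor `ℝ`. -/
def polarParam (α : ℝ → ℝ) (p : ℝ × ℝ × ℝ) : S2 × ℝ :=
  (spherePoint (α p.1) p.2.1, p.2.2)

/-- The symmetric bilinear form `dx² + sin²θ(x) dy² + cos²θ(x) dz²` at the point `p = (x, y, z)`. -/
def warpedForm (θ : ℝ → ℝ) (p v w : ℝ × ℝ × ℝ) : ℝ :=
  v.1 * w.1 + sin (θ p.1) ^ 2 * (v.2.1 * w.2.1) + cos (θ p.1) ^ 2 * (v.2.2 * w.2.2)

/-- The form `dx² + sin²θ(x) dy² + cos²θ(x) dz²`, `0 < x < b`, defines a smooth metric on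
`S² × ℝ`: for some admissible choice of the colatitude as a function of `x`, there is a smooth
Riemannian metric on all of `S² × ℝ` (including the two lines over the poles `x = 0`, `x = b`)
whose pullback to the coordinates `(x, y, z)` is this form. -/
def DefinesSmoothMetricOnS2R (b : ℝ) (θ : ℝ → ℝ) : Prop :=
  ∃ α : ℝ → ℝ, IsColatitude b α ∧ ∃ g : SmoothMetricS2R,
    ∀ p : ℝ × ℝ × ℝ, p.1 ∈ Ioo 0 b → ∀ v w : ℝ × ℝ × ℝ,
      g.inner (polarParam α p)
        (mfderiv 𝓘(ℝ, ℝ × ℝ × ℝ) modelS2R (polarParam α) p v)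
        (mfderiv 𝓘(ℝ, ℝ × ℝ × ℝ) modelS2R (polarParam α) p w) = warpedForm θ p v w

end

noncomputable section

/-! Smoothness over the poles is a parity condition in the colatitude `r`, and both directions
reduce to a computation at one pole; the other follows from the reflection `x ↦ b - x`.

Necessity. `orthogonalParam` is smooth across the poles, and its curve `q.2 = 0` is a full great
circle through both of them. Along this circle let `e r` and `m r` be the squared lengths of its
velocity and of the transverse velocity. Both are smooth; comparing longitudes `0` and `π` shows
that they are even. The pullback identity reads `α'² e(α) = 1` and `sin² θ = sin² α · m(α)`, and `m
0 = e 0` because the transverse great circle through the pole is a meridian too. Hence `α' = κ(α)`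
with `κ = 1/√e` even, and `θ = ψ(α)` with `ψ = arcsin (sin · √m)` odd. The derivatives of `θ` at `0`
are therefore the iterates of `κ · d/dr` on `ψ` at `0` (`iteratedDerivWithin_eq_flowDeriv`). Each
iterate flips parity, so even orders vanish, and the first is `√(m 0) / √(e 0) = 1`. This is
`endpoint_derivatives`.

Sufficiency. Take `α` linear and look for a metric `A ⟨dP, dP⟩ + B dP₃² + C dz²` with coefficients
depending on the height `cos r`. With `c = b / π` the requirements are `A sin² r = sin² θ(c r)`, `A
+ B sin² r = c²` and `C = cos² θ(c r)`. The derivative conditions make the odd extension of `θ`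
smooth, so `sin θ(c r) = sin r · q r` with `q` even and `q 0 = c`; then `A = q²`, and `c² - q²` is
even and vanishes at `0`, hence divisible by `sin² r`. Smooth even functions of `r` are smooth
functions of `cos r` up to the pole (`SmoothParityOn.contDiffOn_comp_arccos`), so `A`, `B`, `C` are
smooth (`exists_coefficients`). -/

theorem contDiff_clm_flip (X Y : Type*) [NormedAddCommGroup X] [NormedSpace ℝ X]
    [NormedAddCommGroup Y] [NormedSpace ℝ Y] :
    ContDiff ℝ ∞ (fun f : X →L[ℝ] Y →L[ℝ] ℝ => f.flip) := by
  have : IsBoundedLinearMap ℝ (fun f : X →L[ℝ] Y →L[ℝ] ℝ => f.flip) :=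
    ⟨⟨fun _ _ => rfl, fun _ _ => rfl⟩, 1, one_pos, fun f => by simp⟩
  exact this.contDiff

/-! ### Smoothness of pulled-back forms, and of a metric along a map -/

section Pullback

variable {E H M V : Type*} [NormedAddCommGroup E] [NormedSpace ℝ E] [TopologicalSpace H]
  {I : ModelWithCorners ℝ E H} [TopologicalSpace M] [ChartedSpace H M]
  [NormedAddCommGroup V] [NormedSpace ℝ V]

/-- The pullback of a field of bilinear forms on a vector space under the differential of a map. -/
def pullbackForm (I : ModelWithCorners ℝ E H) (J : M → V) (Q : M → V →L[ℝ] V →L[ℝ] ℝ) (p : M) :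
    TangentSpace I p →L[ℝ] TangentSpace I p →L[ℝ] ℝ :=
  let L : E →L[ℝ] V := mvfderiv I J p
  let B : E →L[ℝ] E →L[ℝ] ℝ := (Q p).bilinearComp L L
  B

@[simp]
theorem pullbackForm_apply (J : M → V) (Q : M → V →L[ℝ] V →L[ℝ] ℝ) (p : M)
    (v w : TangentSpace I p) :
    pullbackForm I J Q p v w = Q p (mvfderiv I J p v) (mvfderiv I J p w) := rfl

variable [IsManifold I ∞ M]

/-- Read in the tangent trivialization at `p₀`, the differential becomes a map into a fixed space of
operators, where smoothness can be handled by ordinary calculus. -/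
theorem contMDiffAt_mvfderiv_comp_symmL {J : M → V} (hJ : ContMDiff I 𝓘(ℝ, V) ∞ J) (p₀ : M) :
    ContMDiffAt I 𝓘(ℝ, E →L[ℝ] V) ∞
      (fun p => (mvfderiv I J p).comp ((trivializationAt E (TangentSpace I) p₀).symmL ℝ p)) p₀ := by
  have h := (hJ p₀).mfderiv_const (m := ∞) (by simp)
  refine h.congr_of_eventuallyEq (Filter.Eventually.of_forall fun p => ?_)
  ext v
  simp only [inTangentCoordinates, ContinuousLinearMap.inCoordinates,
    TangentBundle.continuousLinearMapAt_model_space]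
  rfl

theorem contMDiff_pullbackForm {J : M → V} (hJ : ContMDiff I 𝓘(ℝ, V) ∞ J)
    {Q : M → V →L[ℝ] V →L[ℝ] ℝ} (hQ : ContMDiff I 𝓘(ℝ, V →L[ℝ] V →L[ℝ] ℝ) ∞ Q) :
    ContMDiff I (I.prod 𝓘(ℝ, E →L[ℝ] E →L[ℝ] ℝ)) ∞
      (fun p => Bundle.TotalSpace.mk' (E →L[ℝ] E →L[ℝ] ℝ)
        (E := fun p : M => TangentSpace I p →L[ℝ] TangentSpace I p →L[ℝ] ℝ)
        p (pullbackForm I J Q p)) := by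
  intro p₀
  rw [contMDiffAt_hom_bundle]
  refine ⟨contMDiffAt_id, ?_⟩
  have hL := contMDiffAt_mvfderiv_comp_symmL hJ p₀
  -- Composition acts on the first argument only; flipping, composing and flipping back reaches the
  -- second.
  have h1 := (hQ p₀).clm_comp hL
  have h2 := (contDiff_clm_flip E V).contMDiff.contMDiffAt.comp p₀ h1
  have h3 := h2.clm_comp hL
  have h4 := (contDiff_clm_flip E E).contMDiff.contMDiffAt.comp p₀ h3
  refine h4.congr_of_eventuallyEq ?_
  have hb : ∀ᶠ p in nhds p₀, p ∈ (trivializationAt E (TangentSpace I) p₀).baseSet :=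
    (trivializationAt E (TangentSpace I) p₀).open_baseSet.mem_nhds
      (FiberBundle.mem_baseSet_trivializationAt' p₀)
  filter_upwards [hb] with p hp
  ext v w
  rw [inCoordinates_apply_eq₂ hp hp (mem_univ _)]
  simp only [Bundle.Trivial.fiberBundle_trivializationAt',
    Bundle.Trivial.linearMapAt_trivialization, LinearMap.id_coe, id_eq, pullbackForm_apply,
    ← Bundle.Trivialization.symmL_apply (R := ℝ) _ hp]
  rfl

variable {W : Type*} [NormedAddCommGroup W] [NormedSpace ℝ W]

/-- The velocity field is the tangent map of `Φ` applied to a constant field, hence a smooth section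
along `Φ`, and the bundle pairing preserves smoothness. -/
theorem contDiff_metric_mfderiv {g : Π p : M, TangentSpace I p →L[ℝ] TangentSpace I p →L[ℝ] ℝ}
    (hg : ContMDiff I (I.prod 𝓘(ℝ, E →L[ℝ] E →L[ℝ] ℝ)) ∞
      (fun p => Bundle.TotalSpace.mk' (E →L[ℝ] E →L[ℝ] ℝ)
        (E := fun p : M => TangentSpace I p →L[ℝ] TangentSpace I p →L[ℝ] ℝ) p (g p)))
    {Φ : W → M} (hΦ : ContMDiff 𝓘(ℝ, W) I ∞ Φ) (u : W) :
    ContDiff ℝ ∞ (fun x : W => g (Φ x) (mfderiv 𝓘(ℝ, W) I Φ x u) (mfderiv 𝓘(ℝ, W) I Φ x u)) := by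
  rw [← contMDiff_iff_contDiff]
  have hv : ContMDiff 𝓘(ℝ, W) I.tangent ∞ (fun x : W =>
      Bundle.TotalSpace.mk' E (E := fun p : M => TangentSpace I p)
        (Φ x) (mfderiv 𝓘(ℝ, W) I Φ x u)) := by
    have hc : ContMDiff 𝓘(ℝ, W) 𝓘(ℝ, W).tangent ∞ (fun x : W =>
      Bundle.TotalSpace.mk' W (E := fun x : W => TangentSpace 𝓘(ℝ, W) x) x u) :=
      contMDiff_vectorSpace_iff_contDiff.2 contDiff_const
    exact (hΦ.contMDiff_tangentMap (m := ∞) (by simp)).comp hc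
  intro x
  have := ContMDiffAt.clm_bundle_apply₂ (IB := I) (n := ∞) (F₁ := E) (F₂ := E) (F₃ := ℝ)
    (E₃ := Bundle.Trivial M ℝ) (b := Φ)
    (ψ := fun x => g (Φ x)) (v := fun x => mfderiv 𝓘(ℝ, W) I Φ x u)
    (w := fun x => mfderiv 𝓘(ℝ, W) I Φ x u) ((hg.comp hΦ) x) (hv x) (hv x)
  rw [Bundle.contMDiffAt_totalSpace] at this
  exact this.2

end Pullback

/-! ### Smooth even and odd functions on a symmetric interval -/

/-- `f` is smooth on `(-a, a)` and even (`s = 1`) or odd (`s = -1`) there. -/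
structure SmoothParityOn (a s : ℝ) (f : ℝ → ℝ) : Prop where
  smooth : ContDiffOn ℝ ∞ f (Ioo (-a) a)
  parity : ∀ r ∈ Ioo (-a) a, f (-r) = s * f r

theorem neg_mem_Ioo_neg {a r : ℝ} (hr : r ∈ Ioo (-a) a) : -r ∈ Ioo (-a) a :=
  ⟨by linarith [hr.2], by linarith [hr.1]⟩

namespace SmoothParityOn

variable {a s t : ℝ} {f g : ℝ → ℝ}

theorem hasDerivAt (hf : SmoothParityOn a s f) {r : ℝ} (hr : r ∈ Ioo (-a) a) :
    HasDerivAt f (deriv f r) r :=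
  ((hf.smooth.differentiableOn (by simp)).differentiableAt (isOpen_Ioo.mem_nhds hr)).hasDerivAt

theorem continuousAt (hf : SmoothParityOn a s f) {r : ℝ} (hr : r ∈ Ioo (-a) a) :
    ContinuousAt f r := (hf.hasDerivAt hr).continuousAt

theorem deriv (hf : SmoothParityOn a s f) : SmoothParityOn a (-s) (deriv f) where
  smooth := hf.smooth.deriv_of_isOpen isOpen_Ioo (by simp)
  parity r hr := by
    have h1 : _root_.deriv (fun x => f (-x)) r = -_root_.deriv f (-r) := deriv_comp_neg f r
    have h2 : (fun x => f (-x)) =ᶠ[nhds r] fun x => s * f x :=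
      Filter.eventually_of_mem (isOpen_Ioo.mem_nhds hr) hf.parity
    rw [h2.deriv_eq, ((hf.hasDerivAt hr).const_mul s).deriv] at h1
    linarith

theorem mul (hf : SmoothParityOn a s f) (hg : SmoothParityOn a t g) :
    SmoothParityOn a (s * t) (fun r => f r * g r) where
  smooth := hf.smooth.mul hg.smooth
  parity r hr := by rw [hf.parity r hr, hg.parity r hr]; ring

theorem mono {a' : ℝ} (hf : SmoothParityOn a s f) (h : a' ≤ a) : SmoothParityOn a' s f where
  smooth := hf.smooth.mono (Ioo_subset_Ioo (neg_le_neg h) h)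
  parity r hr := hf.parity r (Ioo_subset_Ioo (neg_le_neg h) h hr)

end SmoothParityOn

/-! ### Derivatives along an autonomous flow and their parity -/

section Flow

/-- The derivative of `ψ` along the flow of the vector field `κ`, iterated. -/
def flowDeriv (κ : ℝ → ℝ) (ψ : ℝ → ℝ) : ℕ → ℝ → ℝ
  | 0 => ψ
  | k + 1 => fun r => deriv (flowDeriv κ ψ k) r * κ r

theorem SmoothParityOn.flowDeriv {ε s : ℝ} {κ ψ : ℝ → ℝ} (hκ : SmoothParityOn ε 1 κ)
    (hψ : SmoothParityOn ε s ψ) (k : ℕ) :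
    SmoothParityOn ε ((-1) ^ k * s) (flowDeriv κ ψ k) := by
  induction k with
  | zero => simpa [_root_.flowDeriv] using hψ
  | succ k ih =>
    have h := ih.deriv.mul hκ
    rw [show -((-1) ^ k * s) * 1 = (-1) ^ (k + 1) * s by ring] at h
    exact h

/-- Let `θ = ψ ∘ α` on `(0, δ)` with `α' = κ ∘ α` and `α(0+) = 0`. The one-sided derivatives of `θ`
at `0` are the iterated derivatives of `ψ` along `κ` at `0`. -/
theorem iteratedDerivWithin_eq_flowDeriv {b ε s δ : ℝ} {θ α κ ψ : ℝ → ℝ} (hδ : 0 < δ)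
    (hδb : δ ≤ b) (hθ : ContDiffOn ℝ ∞ θ (Icc 0 b)) (hε : 0 < ε)
    (hα0 : Filter.Tendsto α (nhdsWithin 0 (Ioi 0)) (nhds 0))
    (hα : ∀ x ∈ Ioo 0 δ, HasDerivAt α (κ (α x)) x)
    (hαε : ∀ x ∈ Ioo 0 δ, α x ∈ Ioo (-ε) ε)
    (hκ : SmoothParityOn ε 1 κ) (hψ : SmoothParityOn ε s ψ)
    (h : ∀ x ∈ Ioo 0 δ, θ x = ψ (α x)) (k : ℕ) :
    iteratedDerivWithin k θ (Icc 0 b) 0 = flowDeriv κ ψ k 0 := by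
  have hb : 0 < b := hδ.trans_le hδb
  have huniq : UniqueDiffOn ℝ (Icc 0 b) := uniqueDiffOn_Icc hb
  have hk : ∀ k, ∀ x ∈ Ioo 0 δ, iteratedDerivWithin k θ (Icc 0 b) x = flowDeriv κ ψ k (α x) := by
    intro k
    induction k with
    | zero => simpa [flowDeriv] using h
    | succ k ih =>
      intro x hx
      have hxb : Icc 0 b ∈ nhds x := Icc_mem_nhds hx.1 (hx.2.trans_le hδb)
      rw [iteratedDerivWithin_succ, derivWithin_of_mem_nhds hxb]
      have he : iteratedDerivWithin k θ (Icc 0 b) =ᶠ[nhds x] fun y => flowDeriv κ ψ k (α y) :=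
        Filter.eventually_of_mem (isOpen_Ioo.mem_nhds hx) ih
      rw [he.deriv_eq]
      exact (((hκ.flowDeriv hψ k).hasDerivAt (hαε x hx)).comp x (hα x hx)).deriv
  have h0 : (0 : ℝ) ∈ Ioo (-ε) ε := ⟨by linarith, hε⟩
  have hmem : Ioo 0 δ ∈ nhdsWithin (0 : ℝ) (Ioi 0) := Ioo_mem_nhdsGT hδ
  -- Nothing is known about derivatives of `α` at `0`, so the identity passes to the endpoint by
  -- comparing two one-sided limits.
  have l1 : Filter.Tendsto (iteratedDerivWithin k θ (Icc 0 b)) (nhdsWithin 0 (Ioi 0))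
      (nhds (iteratedDerivWithin k θ (Icc 0 b) 0)) := by
    have hc := hθ.continuousOn_iteratedDerivWithin (m := k) (by exact_mod_cast le_top) huniq 0
      (left_mem_Icc.2 hb.le)
    refine hc.mono_left ?_
    rw [← nhdsWithin_Ioo_eq_nhdsGT hb]
    exact nhdsWithin_mono _ Ioo_subset_Icc_self
  have l2 : Filter.Tendsto (fun x => flowDeriv κ ψ k (α x)) (nhdsWithin 0 (Ioi 0))
      (nhds (flowDeriv κ ψ k 0)) :=
    ((hκ.flowDeriv hψ k).continuousAt h0).tendsto.comp hα0
  refine tendsto_nhds_unique l1 (l2.congr' ?_)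
  filter_upwards [hmem] with x hx using (hk k x hx).symm

theorem flowDeriv_two_mul_zero {ε : ℝ} {κ ψ : ℝ → ℝ} (hε : 0 < ε) (hκ : SmoothParityOn ε 1 κ)
    (hψ : SmoothParityOn ε (-1) ψ) (k : ℕ) : flowDeriv κ ψ (2 * k) 0 = 0 := by
  have := (hκ.flowDeriv hψ (2 * k)).parity 0 ⟨by linarith, hε⟩
  rw [pow_mul] at this
  norm_num at this
  linarith

end Flow

/-! ### Smooth even and odd extensions across an endpoint -/

section Reflect

/-- The extension of `f` from `[0, ∞)` to `ℝ` that is even (`s = 1`) or odd (`s = -1`). -/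
def reflectExt (s : ℝ) (f : ℝ → ℝ) (x : ℝ) : ℝ := if 0 ≤ x then f x else s * f (-x)

/-- Differentiation swaps the two kinds of extension. Only one matching condition is needed at `0`:
the value for an odd extension, the slope for an even one. -/
theorem hasDerivAt_reflectExt {b s : ℝ} (hb : 0 < b) (hs : s = 1 ∨ s = -1) {f : ℝ → ℝ}
    (hf : ContDiffOn ℝ ∞ f (Icc 0 b)) (h0 : s = -1 → f 0 = 0)
    (h1 : s = 1 → derivWithin f (Icc 0 b) 0 = 0) {x : ℝ} (hx : x ∈ Ioo (-b) b) :
    HasDerivAt (reflectExt s f) (reflectExt (-s) (derivWithin f (Icc 0 b)) x) x := by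
  have hd : ∀ y ∈ Icc 0 b, HasDerivWithinAt f (derivWithin f (Icc 0 b) y) (Icc 0 b) y := fun y hy =>
    (hf.differentiableOn (by simp) y hy).hasDerivWithinAt
  have hd' : ∀ y ∈ Ioo 0 b, HasDerivAt f (derivWithin f (Icc 0 b) y) y := fun y hy =>
    (hd y (Ioo_subset_Icc_self hy)).hasDerivAt (Icc_mem_nhds hy.1 hy.2)
  rcases lt_trichotomy x 0 with hx0 | rfl | hx0
  · have hx' : -x ∈ Ioo 0 b := ⟨by linarith, by linarith [hx.1]⟩
    have := ((hd' _ hx').comp x (hasDerivAt_neg x)).const_mul s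
    rw [reflectExt, if_neg (not_le.2 hx0)]
    refine (this.congr_of_eventuallyEq ?_).congr_deriv (by ring)
    filter_upwards [Iio_mem_nhds hx0] with y (hy : y < 0)
    simp [reflectExt, not_le.2 hy]
  · have hz := hd 0 (left_mem_Icc.2 hb.le)
    have hright : HasDerivWithinAt f (derivWithin f (Icc 0 b) 0) (Ici 0) 0 :=
      hz.mono_of_mem_nhdsWithin (Icc_mem_nhdsGE hb)
    have hleft : HasDerivWithinAt (fun y => s * f (-y)) (s * (derivWithin f (Icc 0 b) 0 * -1))
        (Iic 0) 0 := by
      refine HasDerivWithinAt.const_mul s ?_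
      refine HasDerivWithinAt.comp (h₂ := f) (h := fun y => -y) (s' := Ici 0) 0 ?_
        (hasDerivAt_neg (0 : ℝ)).hasDerivWithinAt ?_
      · simpa using hright
      · intro y hy; simpa using hy
    have e : s * (derivWithin f (Icc 0 b) 0 * -1) = derivWithin f (Icc 0 b) 0 := by
      rcases hs with h | h
      · simp [h1 h]
      · simp [h]
    rw [e] at hleft
    rw [reflectExt, if_pos le_rfl, ← hasDerivWithinAt_univ, ← Iic_union_Ici (a := (0 : ℝ))]
    refine HasDerivWithinAt.union (hleft.congr (fun y hy => ?_) ?_)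
      (hright.congr (fun y hy => ?_) ?_)
    · rcases eq_or_lt_of_le (show y ≤ 0 from hy) with rfl | hy
      · rcases hs with h | h
        · simp [reflectExt, h]
        · simp [reflectExt, h0 h]
      · simp [reflectExt, not_le.2 hy]
    · rcases hs with h | h
      · simp [reflectExt, h]
      · simp [reflectExt, h0 h]
    · simp [reflectExt, show (0 : ℝ) ≤ y from hy]
    · simp [reflectExt]
  · have := hd' x ⟨hx0, hx.2⟩
    rw [reflectExt, if_pos hx0.le]
    refine this.congr_of_eventuallyEq ?_
    filter_upwards [Ioi_mem_nhds hx0] with y hy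
    simp [reflectExt, (show (0 : ℝ) < y from hy).le]

/-- The `k`-th derivative of the extension has parity `(-1) ^ k * s`, so vanishing at `0` is needed
exactly when this sign is `-1`. Keeping `s` general lets the induction pass from `f` to its
derivative. -/
theorem contDiffOn_reflectExt {b : ℝ} (hb : 0 < b) (n : ℕ) {s : ℝ} (hs : s = 1 ∨ s = -1)
    {f : ℝ → ℝ} (hf : ContDiffOn ℝ ∞ f (Icc 0 b))
    (h : ∀ k : ℕ, (-1) ^ k * s = -1 → iteratedDerivWithin k f (Icc 0 b) 0 = 0) :
    ContDiffOn ℝ n (reflectExt s f) (Ioo (-b) b) := by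
  have hd : ∀ {s : ℝ}, s = 1 ∨ s = -1 → ∀ {f : ℝ → ℝ}, ContDiffOn ℝ ∞ f (Icc 0 b) →
      (∀ k : ℕ, (-1) ^ k * s = -1 → iteratedDerivWithin k f (Icc 0 b) 0 = 0) →
      ∀ x ∈ Ioo (-b) b,
      HasDerivAt (reflectExt s f) (reflectExt (-s) (derivWithin f (Icc 0 b)) x) x := by
    intro s hs f hf h x hx
    refine hasDerivAt_reflectExt hb hs hf (fun e => ?_) (fun e => ?_) hx
    · simpa using h 0 (by simp [e])
    · simpa [iteratedDerivWithin_one] using h 1 (by simp [e])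
  induction n generalizing s f with
  | zero =>
    exact contDiffOn_zero.2 fun x hx => (hd hs hf h x hx).continuousAt.continuousWithinAt
  | succ n ih =>
    push_cast
    rw [contDiffOn_succ_iff_deriv_of_isOpen isOpen_Ioo]
    refine ⟨fun x hx => (hd hs hf h x hx).differentiableAt.differentiableWithinAt,
      fun h => by simp at h, ?_⟩
    refine (ih (s := -s) (f := derivWithin f (Icc 0 b)) ?_ ?_ ?_).congr
      fun x hx => (hd hs hf h x hx).deriv
    · rcases hs with h | h <;> simp [h]
    · exact hf.derivWithin (uniqueDiffOn_Icc hb) (by simp)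
    · intro k hk
      rw [← iteratedDerivWithin_succ']
      exact h _ (by rw [pow_succ]; linarith)

theorem smoothParityOn_reflectExt {b : ℝ} (hb : 0 < b) {f : ℝ → ℝ}
    (hf : ContDiffOn ℝ ∞ f (Icc 0 b))
    (h : ∀ k : ℕ, iteratedDerivWithin (2 * k) f (Icc 0 b) 0 = 0) :
    SmoothParityOn b (-1) (reflectExt (-1) f) where
  smooth := contDiffOn_infty.2 fun n => contDiffOn_reflectExt hb n (.inr rfl) hf fun k hk => by
    have : Even k := by
      by_contra hk'
      rw [Nat.not_even_iff_odd] at hk'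
      rw [hk'.neg_one_pow] at hk; norm_num at hk
    obtain ⟨j, rfl⟩ := this.two_dvd
    exact h j
  parity r _ := by
    have h0 : f 0 = 0 := by simpa using h 0
    rcases lt_trichotomy r 0 with hr | rfl | hr
    · simp [reflectExt, hr.le, not_le.2 hr]
    · simp [reflectExt, h0]
    · simp [reflectExt, hr.le, not_le.2 hr]

end Reflect

/-! ### Division of smooth functions by `r` and by `sin r` -/

section Division

/-- Each derivative in `r` produces a factor `t`; the arbitrary weight `w` absorbs it, so that the
formula can be iterated. -/
theorem hasDerivAt_integral_mul_comp_mul {a : ℝ} {w φ : ℝ → ℝ} (hw : Continuous w)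
    (hφ : ContDiffOn ℝ ∞ φ (Ioo (-a) a)) {r : ℝ} (hr : r ∈ Ioo (-a) a) :
    HasDerivAt (fun r => ∫ t in (0 : ℝ)..1, w t * φ (t * r))
      (∫ t in (0 : ℝ)..1, (w t * t) * deriv φ (t * r)) r := by
  -- On the compact interval `[-ρ, ρ]` the derivative of `φ` is bounded, which supplies the
  -- dominating constant.
  obtain ⟨ρ, hρ1, hρ2⟩ : ∃ ρ, |r| < ρ ∧ ρ < a := exists_between (abs_lt.2 hr)
  have hρ0 : 0 < ρ := (abs_nonneg r).trans_lt hρ1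
  have hsub : Icc (-ρ) ρ ⊆ Ioo (-a) a := Icc_subset_Ioo (by linarith) hρ2
  have hmul : ∀ t ∈ Icc (0 : ℝ) 1, ∀ x ∈ Ioo (-ρ) ρ, t * x ∈ Icc (-ρ) ρ := by
    intro t ht x hx
    have : |t * x| ≤ ρ := by
      rw [abs_mul, abs_of_nonneg ht.1]
      nlinarith [abs_lt.2 hx, abs_nonneg x, ht.2, ht.1]
    exact abs_le.1 this
  have hdφ : ContinuousOn (deriv φ) (Ioo (-a) a) :=
    (hφ.deriv_of_isOpen (m := ∞) isOpen_Ioo (by simp)).continuousOn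
  obtain ⟨C, hC⟩ := isCompact_Icc.exists_bound_of_continuousOn (hdφ.mono hsub)
  obtain ⟨D, hD⟩ := (isCompact_Icc (a := (0 : ℝ)) (b := 1)).exists_bound_of_continuousOn
    (hw.mul continuous_id).continuousOn
  have hcont : ∀ x ∈ Ioo (-ρ) ρ, ContinuousOn (fun t => w t * φ (t * x)) (Icc 0 1) := fun x hx =>
    hw.continuousOn.mul ((hφ.continuousOn.mono hsub).comp (by fun_prop) fun t ht => hmul t ht x hx)
  have hcont' : ContinuousOn (fun t => (w t * t) * deriv φ (t * r)) (Icc 0 1) :=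
    (hw.mul continuous_id).continuousOn.mul
      ((hdφ.mono hsub).comp (by fun_prop) fun t ht => hmul t ht r (abs_lt.1 hρ1))
  have hIoc : uIoc (0 : ℝ) 1 ⊆ Icc 0 1 := by
    rw [uIoc_of_le zero_le_one]; exact Ioc_subset_Icc_self
  refine (intervalIntegral.hasDerivAt_integral_of_dominated_loc_of_deriv_le
    (F := fun r t => w t * φ (t * r)) (F' := fun r t => (w t * t) * deriv φ (t * r))
    (bound := fun _ => D * C)
    (isOpen_Ioo.mem_nhds (abs_lt.1 hρ1)) ?_ ?_ ?_ ?_ ?_ ?_).2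
  · filter_upwards [isOpen_Ioo.mem_nhds (abs_lt.1 hρ1)] with x hx
    exact ((hcont x hx).mono hIoc).aestronglyMeasurable measurableSet_uIoc
  · refine ContinuousOn.intervalIntegrable ?_
    rw [uIcc_of_le zero_le_one]; exact hcont r (abs_lt.1 hρ1)
  · exact (hcont'.mono hIoc).aestronglyMeasurable measurableSet_uIoc
  · refine Filter.Eventually.of_forall fun t ht x hx => ?_
    rw [norm_mul]
    have h1 := hD t (hIoc ht)
    have h2 := hC _ (hmul t (hIoc ht) x hx)
    exact mul_le_mul h1 h2 (norm_nonneg _) ((norm_nonneg _).trans h1)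
  · exact intervalIntegrable_const
  · refine Filter.Eventually.of_forall fun t ht x hx => ?_
    have hm := hsub (hmul t (hIoc ht) x hx)
    have h1 : HasDerivAt φ (deriv φ (t * x)) (t * x) :=
      ((hφ.differentiableOn (by simp)).differentiableAt (isOpen_Ioo.mem_nhds hm)).hasDerivAt
    have h2 : HasDerivAt (fun x => t * x) t x := by simpa using (hasDerivAt_id x).const_mul t
    exact ((h1.comp x h2).const_mul (w t)).congr_deriv (by ring)

theorem contDiffOn_integral_mul_comp_mul {a : ℝ} (n : ℕ) {w φ : ℝ → ℝ} (hw : Continuous w)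
    (hφ : ContDiffOn ℝ ∞ φ (Ioo (-a) a)) :
    ContDiffOn ℝ n (fun r => ∫ t in (0 : ℝ)..1, w t * φ (t * r)) (Ioo (-a) a) := by
  induction n generalizing w φ with
  | zero =>
    exact contDiffOn_zero.2 fun r hr =>
      (hasDerivAt_integral_mul_comp_mul hw hφ hr).continuousAt.continuousWithinAt
  | succ n ih =>
    push_cast
    rw [contDiffOn_succ_iff_deriv_of_isOpen isOpen_Ioo]
    refine ⟨fun r hr =>
        (hasDerivAt_integral_mul_comp_mul hw hφ hr).differentiableAt.differentiableWithinAt,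
      fun h => by simp at h, ?_⟩
    exact (ih (hw.mul continuous_id) (hφ.deriv_of_isOpen isOpen_Ioo (by simp))).congr
      fun r hr => (hasDerivAt_integral_mul_comp_mul hw hφ hr).deriv

/-- Hadamard's lemma: a smooth function vanishing at `0` is a smooth multiple of the identity. -/
theorem exists_contDiffOn_eq_mul {a : ℝ} {f : ℝ → ℝ}
    (hf : ContDiffOn ℝ ∞ f (Ioo (-a) a)) (h0 : f 0 = 0) :
    ∃ h : ℝ → ℝ, ContDiffOn ℝ ∞ h (Ioo (-a) a) ∧ h 0 = deriv f 0 ∧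
      ∀ r ∈ Ioo (-a) a, f r = r * h r := by
  have hdf : ContDiffOn ℝ ∞ (deriv f) (Ioo (-a) a) := hf.deriv_of_isOpen isOpen_Ioo (by simp)
  -- The quotient comes from integrating `d/dt f(t r) = r f'(t r)` over `[0, 1]`.
  refine ⟨fun r => ∫ t in (0 : ℝ)..1, 1 * deriv f (t * r),
    contDiffOn_infty.2 fun n => contDiffOn_integral_mul_comp_mul n continuous_const hdf,
    by simp, fun r hr => ?_⟩
  have hm : ∀ t ∈ uIcc (0 : ℝ) 1, t * r ∈ Ioo (-a) a := by
    intro t ht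
    rw [uIcc_of_le zero_le_one] at ht
    have h1 := abs_lt.2 hr
    refine abs_lt.1 ?_
    rw [abs_mul, abs_of_nonneg ht.1]
    nlinarith [abs_nonneg r, ht.2]
  have key := intervalIntegral.integral_eq_sub_of_hasDerivAt (a := 0) (b := 1)
    (f := fun t => f (t * r)) (f' := fun t => deriv f (t * r) * r) (fun t ht => ?_) ?_
  · simp only [one_mul, zero_mul, h0, sub_zero] at key ⊢
    rw [← key, intervalIntegral.integral_mul_const, mul_comm]
  · have h1 : HasDerivAt f (deriv f (t * r)) (t * r) :=
      ((hf.differentiableOn (by simp)).differentiableAt (isOpen_Ioo.mem_nhds (hm t ht))).hasDerivAt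
    have h2 : HasDerivAt (fun t => t * r) r t := by simpa using (hasDerivAt_id t).mul_const r
    exact h1.comp t h2
  · refine ContinuousOn.intervalIntegrable ?_
    exact (hdf.continuousOn.comp (by fun_prop) hm).mul continuousOn_const

/-- Divide both `f` and `sin` by `r`: the quotient of `sin` has no zero on `(-π, π)`, so the ratio
is smooth. Its parity away from `0` follows by cancelling `sin r`, and at `0` from the parity of
`f'`. -/
theorem SmoothParityOn.exists_eq_sin_mul {s : ℝ} {f : ℝ → ℝ} (hf : SmoothParityOn π s f)
    (h0 : f 0 = 0) :
    ∃ h : ℝ → ℝ, SmoothParityOn π (-s) h ∧ h 0 = _root_.deriv f 0 ∧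
      ∀ r ∈ Ioo (-π) π, f r = sin r * h r := by
  obtain ⟨u, hu, hu0, hfu⟩ := exists_contDiffOn_eq_mul hf.smooth h0
  obtain ⟨v, hv, hv0, hsv⟩ := exists_contDiffOn_eq_mul
    (f := sin) contDiff_sin.contDiffOn sin_zero
  rw [Real.deriv_sin, cos_zero] at hv0
  have hsin : ∀ r ∈ Ioo (-π) π, r ≠ 0 → sin r ≠ 0 := fun r hr hr0 h =>
    hr0 ((sin_eq_zero_iff_of_lt_of_lt hr.1 hr.2).1 h)
  have hvne : ∀ r ∈ Ioo (-π) π, v r ≠ 0 := by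
    intro r hr hv
    rcases eq_or_ne r 0 with rfl | hr0
    · rw [hv] at hv0; norm_num at hv0
    · exact hsin r hr hr0 (by rw [hsv r hr, hv, mul_zero])
  have heq : ∀ r ∈ Ioo (-π) π, f r = sin r * (u r / v r) := fun r hr => by
    rw [hfu r hr, hsv r hr]; field_simp [hvne r hr]
  have hh0 : u 0 / v 0 = _root_.deriv f 0 := by rw [hv0, hu0, div_one]
  refine ⟨fun r => u r / v r, ⟨hu.div hv hvne, fun r hr => ?_⟩, hh0, heq⟩
  rcases eq_or_ne r 0 with rfl | hr0
  · simpa only [neg_zero, hh0] using hf.deriv.parity 0 hr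
  · have h1 := hf.parity r hr
    rw [heq r hr, heq _ (neg_mem_Ioo_neg hr), sin_neg] at h1
    refine mul_left_cancel₀ (hsin r hr hr0) ?_
    linarith

end Division

/-! ### Even functions of the angle as functions of its cosine -/

section Arccos

theorem arccos_mem_Ioo_of_mem_Ioc {t : ℝ} (ht : t ∈ Ioc (-1) 1) : arccos t ∈ Ioo (-π) π :=
  ⟨by linarith [arccos_nonneg t, pi_pos], (arccos_lt_pi).2 ht.1⟩

/-- With `t = cos r` the derivative is `-f'(r) / sin r`. Since `f'` is odd this quotient is again
smooth and even, so the class is closed under differentiation in `t`. -/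
theorem exists_hasDerivWithinAt_comp_arccos {f : ℝ → ℝ} (hf : SmoothParityOn π 1 f) :
    ∃ g : ℝ → ℝ, SmoothParityOn π 1 g ∧ ∀ t ∈ Ioc (-1 : ℝ) 1,
      HasDerivWithinAt (fun t => f (arccos t)) (g (arccos t)) (Ioc (-1) 1) t := by
  have hd0 : deriv f 0 = 0 := by
    have := hf.deriv.parity 0 ⟨by linarith [pi_pos], pi_pos⟩
    rw [neg_zero] at this; linarith
  obtain ⟨h, hh, -, hfh⟩ := hf.deriv.exists_eq_sin_mul hd0
  have hg : SmoothParityOn π 1 (fun r => -h r) :=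
    ⟨hh.smooth.neg, fun r hr => by rw [hh.parity r hr]; ring⟩
  have hopen : ∀ t ∈ Ioo (-1 : ℝ) 1, HasDerivAt (fun t => f (arccos t)) (-h (arccos t)) t := by
    intro t ht
    have hm := arccos_mem_Ioo_of_mem_Ioc (Ioo_subset_Ioc_self ht)
    have hs : 0 < sin (arccos t) :=
      sin_pos_of_pos_of_lt_pi (arccos_pos.2 ht.2) hm.2
    refine ((hf.hasDerivAt hm).comp t (hasDerivAt_arccos ht.1.ne' ht.2.ne)).congr_deriv ?_
    rw [hfh _ hm, ← sin_arccos]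
    field_simp
  have hcont : ∀ k : ℝ → ℝ, SmoothParityOn π 1 k → ∀ t ∈ Ioc (-1 : ℝ) 1,
      ContinuousAt (fun t => k (arccos t)) t := fun k hk t ht =>
    (hk.continuousAt (arccos_mem_Ioo_of_mem_Ioc ht)).comp (f := arccos)
      continuous_arccos.continuousAt
  refine ⟨_, hg, fun t ht => ?_⟩
  rcases eq_or_lt_of_le ht.2 with rfl | h1
  -- `arccos` is not differentiable at `1`; the one-sided derivative is the limit of the derivatives
  -- from the left.
  · refine HasDerivWithinAt.mono (t := Iic 1) ?_ fun x hx => hx.2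
    refine hasDerivWithinAt_Iic_of_tendsto_deriv (s := Ioo (-1) 1)
      (fun t ht => (hopen t ht).differentiableAt.differentiableWithinAt)
      (hcont f hf 1 ht).continuousWithinAt (Ioo_mem_nhdsLT (by norm_num)) ?_
    refine ((hcont _ hg 1 ht).tendsto.mono_left nhdsWithin_le_nhds).congr' ?_
    filter_upwards [Ioo_mem_nhdsLT (show (-1 : ℝ) < 1 by norm_num)] with x hx
    exact (hopen x hx).deriv.symm
  · exact (hopen t ⟨ht.1, h1⟩).hasDerivWithinAt

/-- A smooth even function of the angle `r` is a smooth function of `cos r`, up to `cos r = 1`. -/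
theorem SmoothParityOn.contDiffOn_comp_arccos {f : ℝ → ℝ} (hf : SmoothParityOn π 1 f) :
    ContDiffOn ℝ ∞ (fun t => f (arccos t)) (Ioc (-1) 1) := by
  refine contDiffOn_infty.2 fun n => ?_
  induction n generalizing f with
  | zero =>
    obtain ⟨g, -, hg⟩ := exists_hasDerivWithinAt_comp_arccos hf
    exact contDiffOn_zero.2 fun t ht => (hg t ht).continuousWithinAt
  | succ n ih =>
    obtain ⟨g, hgp, hg⟩ := exists_hasDerivWithinAt_comp_arccos hf
    have hu : UniqueDiffOn ℝ (Ioc (-1 : ℝ) 1) := uniqueDiffOn_Ioc _ _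
    push_cast
    rw [contDiffOn_succ_iff_derivWithin hu]
    exact ⟨fun t ht => (hg t ht).differentiableWithinAt, fun h => by simp at h,
      (ih hgp).congr fun t ht => (hg t ht).derivWithin (hu t ht)⟩

end Arccos

/-! ### Boundedness of the unit ball of a positive definite form -/

section PosDef

variable {E : Type*} [NormedAddCommGroup E] [NormedSpace ℝ E] [FiniteDimensional ℝ E]

theorem isVonNBounded_of_posDef (B : E →L[ℝ] E →L[ℝ] ℝ) (hB : ∀ v, v ≠ 0 → 0 < B v v) :
    Bornology.IsVonNBounded ℝ {v : E | B v v < 1} := by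
  rw [NormedSpace.isVonNBounded_iff, isBounded_iff_forall_norm_le]
  rcases (Metric.sphere (0 : E) 1).eq_empty_or_nonempty with h | h
  -- An empty unit sphere means that `E` is trivial.
  · refine ⟨0, fun v _ => ?_⟩
    by_contra hv
    have hv0 : v ≠ 0 := fun h => hv (by simp [h])
    have : (‖v‖⁻¹ • v) ∈ Metric.sphere (0 : E) 1 := by
      simp [norm_smul, inv_mul_cancel₀ (norm_ne_zero_iff.2 hv0)]
    rw [h] at this; exact this
  · obtain ⟨u, hu, hmin⟩ := (isCompact_sphere (0 : E) 1).exists_isMinOn h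
      (f := fun v => B v v) (by fun_prop)
    have hu0 : u ≠ 0 := by rintro rfl; simp at hu
    have hc := hB u hu0
    -- `B u u` is the minimum on the unit sphere, so `B v v ≥ B u u * ‖v‖²`.
    refine ⟨√(1 / B u u), fun v (hv : B v v < 1) => ?_⟩
    rcases eq_or_ne v 0 with rfl | hv0
    · simp
    have hn : 0 < ‖v‖ := norm_pos_iff.2 hv0
    have hw : (‖v‖⁻¹ • v) ∈ Metric.sphere (0 : E) 1 := by
      simp [norm_smul, inv_mul_cancel₀ hn.ne']
    have h1 : B u u ≤ B (‖v‖⁻¹ • v) (‖v‖⁻¹ • v) := hmin hw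
    simp only [map_smul, smul_apply, smul_eq_mul] at h1
    refine Real.le_sqrt_of_sq_le ?_
    rw [le_div_iff₀ hc]
    have h2 : ‖v‖ ^ 2 * B u u ≤ ‖v‖ ^ 2 * (‖v‖⁻¹ * (‖v‖⁻¹ * B v v)) := by gcongr
    have h3 : ‖v‖ ^ 2 * (‖v‖⁻¹ * (‖v‖⁻¹ * B v v)) = B v v := by field_simp
    linarith

end PosDef

theorem mvfderiv_vector_comp_apply {V E H M E' H' M' : Type*} [NormedAddCommGroup V]
    [NormedSpace ℝ V] [NormedAddCommGroup E] [NormedSpace ℝ E] [TopologicalSpace H]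
    {I : ModelWithCorners ℝ E H} [TopologicalSpace M] [ChartedSpace H M]
    [NormedAddCommGroup E'] [NormedSpace ℝ E'] [TopologicalSpace H']
    {I' : ModelWithCorners ℝ E' H'} [TopologicalSpace M'] [ChartedSpace H' M']
    {g : M → V} {f : M' → M} (x : M') (hg : MDifferentiableAt I 𝓘(ℝ, V) g (f x))
    (hf : MDifferentiableAt I' I f x) (v : TangentSpace I' x) :
    mvfderiv I' (g ∘ f) x v = mvfderiv I g (f x) (mfderiv I' I f x v) :=
  mfderiv_comp_apply x hg hf v

/-! ### Tangent vectors of `S² × ℝ` seen in `ℝ³ × ℝ` -/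

section Ambient

/-- The ambient space `ℝ³ × ℝ` of `S² × ℝ`. -/
abbrev AmbientSpace : Type := EuclideanSpace ℝ (Fin 3) × ℝ

/-- The inclusion of `S² × ℝ` in `ℝ³ × ℝ`. -/
def ambient (p : S2 × ℝ) : AmbientSpace := (p.1, p.2)

instance : Fact (Module.finrank ℝ (EuclideanSpace ℝ (Fin 3)) = 2 + 1) := ⟨by simp⟩

theorem contMDiff_ambient : ContMDiff modelS2R 𝓘(ℝ, AmbientSpace) ∞ ambient :=
  (contMDiff_coe_sphere.comp contMDiff_fst).prodMk_space contMDiff_snd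

theorem mdifferentiableAt_ambient (p : S2 × ℝ) :
    MDifferentiableAt modelS2R 𝓘(ℝ, AmbientSpace) ambient p :=
  (contMDiff_ambient p).mdifferentiableAt (by simp)

theorem mvfderiv_ambient_fst (p : S2 × ℝ) (v : TangentSpace modelS2R p) :
    (mvfderiv modelS2R ambient p v).1 =
      mvfderiv (𝓡 2) ((↑) : S2 → EuclideanSpace ℝ (Fin 3)) p.1 v.1 := by
  have h1 := mvfderiv_vector_comp_apply (f := ambient)
    (g := (Prod.fst : AmbientSpace → EuclideanSpace ℝ (Fin 3))) p
    (DifferentiableAt.mdifferentiableAt (f := (Prod.fst : AmbientSpace → _)) differentiableAt_fst)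
    (mdifferentiableAt_ambient p) v
  have h2 := mvfderiv_vector_comp_apply
    (g := ((↑) : S2 → EuclideanSpace ℝ (Fin 3))) (f := (Prod.fst : S2 × ℝ → S2)) p
    ((contMDiff_coe_sphere (m := ∞) p.1).mdifferentiableAt (by simp))
    (mdifferentiableAt_fst (I := 𝓡 2) (I' := 𝓘(ℝ, ℝ))) v
  rw [mfderiv_fst] at h2
  have h3 : mvfderiv 𝓘(ℝ, AmbientSpace) (Prod.fst : AmbientSpace → EuclideanSpace ℝ (Fin 3))
      (ambient p) = ContinuousLinearMap.fst ℝ _ _ := by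
    rw [mvfderiv, mfderiv_eq_fderiv, fderiv_fst]; rfl
  rw [h3] at h1
  exact h1.symm.trans h2

theorem mvfderiv_ambient_snd (p : S2 × ℝ) (v : TangentSpace modelS2R p) :
    (mvfderiv modelS2R ambient p v).2 = v.2 := by
  have h1 := mvfderiv_vector_comp_apply (f := ambient) (g := (Prod.snd : AmbientSpace → ℝ)) p
    (DifferentiableAt.mdifferentiableAt (f := (Prod.snd : AmbientSpace → _)) differentiableAt_snd)
    (mdifferentiableAt_ambient p) v
  have h3 : mvfderiv 𝓘(ℝ, AmbientSpace) (Prod.snd : AmbientSpace → ℝ)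
      (ambient p) = ContinuousLinearMap.snd ℝ _ _ := by
    rw [mvfderiv, mfderiv_eq_fderiv, fderiv_snd]; rfl
  have h2 : mvfderiv modelS2R (Prod.snd : S2 × ℝ → ℝ) p v = v.2 := by
    rw [mvfderiv, mfderiv_snd]; rfl
  rw [h3] at h1
  exact h1.symm.trans h2

theorem injective_mvfderiv_ambient (p : S2 × ℝ) :
    Function.Injective (mvfderiv modelS2R ambient p) := by
  intro v w h
  refine Prod.ext ?_ ?_
  · refine injective_mvfderiv_subtypeVal_sphere p.1 ?_
    rw [← mvfderiv_ambient_fst, h, mvfderiv_ambient_fst]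
  · rw [← mvfderiv_ambient_snd, h, mvfderiv_ambient_snd]

theorem inner_mvfderiv_ambient (p : S2 × ℝ) (v : TangentSpace modelS2R p) :
    inner ℝ (p.1 : EuclideanSpace ℝ (Fin 3)) (mvfderiv modelS2R ambient p v).1 = 0 := by
  have h : (mvfderiv modelS2R ambient p v).1 ∈
      (mvfderiv (𝓡 2) ((↑) : S2 → EuclideanSpace ℝ (Fin 3)) p.1).range := by
    rw [mvfderiv_ambient_fst]; exact ⟨_, rfl⟩
  rw [range_mvfderiv_subtypeVal] at h
  exact Submodule.mem_orthogonal_singleton_iff_inner_right.1 h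

/-- Reduces manifold derivatives to differentiating explicit curves in `ℝ³ × ℝ`; as the ambient
differential is injective, this determines the tangent vector. -/
theorem mvfderiv_ambient_mfderiv {W : Type*} [NormedAddCommGroup W] [NormedSpace ℝ W]
    {f : W → S2 × ℝ} {x u : W} (hf : MDifferentiableAt 𝓘(ℝ, W) modelS2R f x) {d : AmbientSpace}
    (h : HasDerivAt (fun t : ℝ => ambient (f (x + t • u))) d 0) :
    mvfderiv modelS2R ambient (f x) (mfderiv 𝓘(ℝ, W) modelS2R f x u) = d := by
  have h1 := mvfderiv_vector_comp_apply (g := ambient) x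
    (mdifferentiableAt_ambient (f x)) hf u
  rw [← h1]
  have hd : DifferentiableAt ℝ (ambient ∘ f) x :=
    ((mdifferentiableAt_ambient (f x)).comp x hf).differentiableAt
  have h2 : mvfderiv 𝓘(ℝ, W) (ambient ∘ f) x u = fderiv ℝ (ambient ∘ f) x u := by
    rw [mvfderiv, mfderiv_eq_fderiv]; rfl
  have h3 : HasDerivAt (fun t : ℝ => x + t • u) u 0 := by
    simpa using ((hasDerivAt_id (0 : ℝ)).smul_const u).const_add x
  have h4 : HasFDerivAt (ambient ∘ f) (fderiv ℝ (ambient ∘ f) x) (x + (0 : ℝ) • u) := by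
    simpa using hd.hasFDerivAt
  rw [h2]
  have h5 : HasDerivAt (fun t : ℝ => ambient (f (x + t • u))) (fderiv ℝ (ambient ∘ f) x u) 0 :=
    HasFDerivAt.comp_hasDerivAt (l := ambient ∘ f) (0 : ℝ) h4 h3
  exact h5.unique h

theorem hasDerivAt_euclidean_three {f g h : ℝ → ℝ} {f' g' h' t : ℝ} (hf : HasDerivAt f f' t)
    (hg : HasDerivAt g g' t) (hh : HasDerivAt h h' t) :
    HasDerivAt (fun t => (!₂[f t, g t, h t] : EuclideanSpace ℝ (Fin 3))) !₂[f', g', h'] t := by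
  have hp : HasDerivAt (fun t => ![f t, g t, h t]) ![f', g', h'] t := by
    rw [hasDerivAt_pi]
    intro i
    fin_cases i <;> simpa
  let L := (PiLp.continuousLinearEquiv 2 ℝ (fun _ : Fin 3 => ℝ)).symm.toContinuousLinearMap
  exact L.hasFDerivAt.comp_hasDerivAt t hp

theorem contMDiff_spherePoint :
    ContMDiff 𝓘(ℝ, ℝ × ℝ) (𝓡 2) ∞ (fun q : ℝ × ℝ => spherePoint q.1 q.2) := by
  have h : ContMDiff 𝓘(ℝ, ℝ × ℝ) 𝓘(ℝ, EuclideanSpace ℝ (Fin 3)) ∞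
      (fun q : ℝ × ℝ => (spherePoint q.1 q.2 : EuclideanSpace ℝ (Fin 3))) := by
    rw [contMDiff_iff_contDiff, contDiff_euclidean]
    intro i
    fin_cases i <;> simp [spherePoint] <;> fun_prop
  exact h.codRestrict_sphere fun q => (spherePoint q.1 q.2).2

theorem mdifferentiableAt_polarParam {α : ℝ → ℝ} {p : ℝ × ℝ × ℝ} (hα : DifferentiableAt ℝ α p.1) :
    MDifferentiableAt 𝓘(ℝ, ℝ × ℝ × ℝ) modelS2R (polarParam α) p := by
  have h1 : DifferentiableAt ℝ (fun p : ℝ × ℝ × ℝ => (α p.1, p.2.1)) p :=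
    (hα.comp p differentiableAt_fst).prodMk (by fun_prop)
  have h2 := (contMDiff_spherePoint (α p.1, p.2.1)).mdifferentiableAt (by simp)
  exact (h2.comp p h1.mdifferentiableAt).prodMk
    (DifferentiableAt.mdifferentiableAt (f := fun p : ℝ × ℝ × ℝ => p.2.2) (by fun_prop))

theorem mvfderiv_ambient_mfderiv_polarParam {α : ℝ → ℝ} {p : ℝ × ℝ × ℝ} {a : ℝ}
    (hα : HasDerivAt α a p.1) (v : ℝ × ℝ × ℝ) :
    mvfderiv modelS2R ambient (polarParam α p)
      (mfderiv 𝓘(ℝ, ℝ × ℝ × ℝ) modelS2R (polarParam α) p v) =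
      (!₂[cos (α p.1) * (a * v.1) * cos p.2.1 - sin (α p.1) * (sin p.2.1 * v.2.1),
        cos (α p.1) * (a * v.1) * sin p.2.1 + sin (α p.1) * (cos p.2.1 * v.2.1),
        -(sin (α p.1) * (a * v.1))], v.2.2) := by
  refine mvfderiv_ambient_mfderiv (mdifferentiableAt_polarParam hα.differentiableAt) ?_
  have hlin : ∀ c d : ℝ, HasDerivAt (fun t : ℝ => c + t * d) d 0 := fun c d => by
    simpa using ((hasDerivAt_id (0 : ℝ)).mul_const d).const_add c
  have hα' : HasDerivAt (fun t : ℝ => α (p.1 + t * v.1)) (a * v.1) 0 := by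
    refine HasDerivAt.comp (h₂ := α) (0 : ℝ) ?_ (hlin p.1 v.1)
    simpa using hα
  have hs : HasDerivAt (fun t : ℝ => sin (α (p.1 + t * v.1))) _ 0 := hα'.sin
  have hc : HasDerivAt (fun t : ℝ => cos (α (p.1 + t * v.1))) _ 0 := hα'.cos
  have hsy : HasDerivAt (fun t : ℝ => sin (p.2.1 + t * v.2.1)) _ 0 := (hlin p.2.1 v.2.1).sin
  have hcy : HasDerivAt (fun t : ℝ => cos (p.2.1 + t * v.2.1)) _ 0 := (hlin p.2.1 v.2.1).cos
  refine ((hasDerivAt_euclidean_three (hs.mul hcy) (hs.mul hsy) hc).prodMk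
    (hlin p.2.2 v.2.2)).congr_deriv ?_
  simp only [zero_mul, add_zero]
  congr 4 <;> ring_nf

end Ambient

/-! ### Metrics with coefficients depending on the height -/

section ConstructMetric

/-- The square of a linear form, as a symmetric bilinear form. -/
def formSquare (l : AmbientSpace →L[ℝ] ℝ) : AmbientSpace →L[ℝ] AmbientSpace →L[ℝ] ℝ :=
  (ContinuousLinearMap.mul ℝ ℝ).bilinearComp l l

/-- The `i`-th coordinate of the factor `ℝ³` of `ℝ³ × ℝ`. -/
def ambientCoord (i : Fin 3) : AmbientSpace →L[ℝ] ℝ :=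
  (EuclideanSpace.proj i).comp (ContinuousLinearMap.fst ℝ (EuclideanSpace ℝ (Fin 3)) ℝ)

/-- The bilinear form `a ⟨u, w⟩ + b u₃ w₃ + c u₄ w₄` on `ℝ³ × ℝ`. -/
def ambientForm (a b c : ℝ) : AmbientSpace →L[ℝ] AmbientSpace →L[ℝ] ℝ :=
  a • (formSquare (ambientCoord 0) + formSquare (ambientCoord 1) + formSquare (ambientCoord 2)) +
    b • formSquare (ambientCoord 2) +
    c • formSquare (ContinuousLinearMap.snd ℝ (EuclideanSpace ℝ (Fin 3)) ℝ)

theorem ambientForm_apply (a b c : ℝ) (u w : AmbientSpace) :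
    ambientForm a b c u w = a * (u.1 0 * w.1 0 + u.1 1 * w.1 1 + u.1 2 * w.1 2) +
      b * (u.1 2 * w.1 2) + c * (u.2 * w.2) := rfl

theorem contDiff_smul_add_smul_add_smul {X : Type*} [NormedAddCommGroup X] [NormedSpace ℝ X]
    (x y z : X) : ContDiff ℝ ∞ fun q : ℝ × ℝ × ℝ => q.1 • x + q.2.1 • y + q.2.2 • z := by
  fun_prop

theorem contDiff_ambientForm :
    ContDiff ℝ ∞ fun q : ℝ × ℝ × ℝ => ambientForm q.1 q.2.1 q.2.2 :=
  contDiff_smul_add_smul_add_smul _ _ _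

/-- For `u` tangent to the sphere at `P`, Cauchy–Schwarz gives `u₃² ≤ (1 - P₃²) |u|²`. Thus `b` may
be negative as long as `a + b (1 - P₃²)`, the coefficient in the meridian direction, stays positive.
-/
theorem ambientForm_pos {a b c : ℝ} {P : S2} (ha : 0 < a) (hc : 0 < c)
    (hab : 0 < a + b * (1 - (P : EuclideanSpace ℝ (Fin 3)) 2 ^ 2)) {u : AmbientSpace}
    (hu : u ≠ 0) (hPu : inner ℝ (P : EuclideanSpace ℝ (Fin 3)) u.1 = 0) :
    0 < ambientForm a b c u u := by
  obtain ⟨⟨P, hP⟩⟩ : Nonempty {Q : S2 // Q = P} := ⟨⟨P, rfl⟩⟩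
  subst hP
  set p0 := (P : EuclideanSpace ℝ (Fin 3)) 0 with hp0
  set p1 := (P : EuclideanSpace ℝ (Fin 3)) 1 with hp1
  set p2 := (P : EuclideanSpace ℝ (Fin 3)) 2 with hp2
  have hn : p0 ^ 2 + p1 ^ 2 + p2 ^ 2 = 1 := by
    have h := P.2
    rw [mem_sphere_zero_iff_norm, EuclideanSpace.norm_eq, Real.sqrt_eq_one] at h
    simpa [Fin.sum_univ_three] using h
  have ho : p0 * u.1 0 + p1 * u.1 1 + p2 * u.1 2 = 0 := by
    rw [PiLp.inner_apply] at hPu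
    simp [Fin.sum_univ_three] at hPu
    linarith
  rw [ambientForm_apply]
  set x := u.1 0
  set y := u.1 1
  set z := u.1 2
  have hz : z ^ 2 ≤ (1 - p2 ^ 2) * (x ^ 2 + y ^ 2 + z ^ 2) := by
    have h1 : (p2 * z) ^ 2 = (p0 * x + p1 * y) ^ 2 := by
      rw [show p2 * z = -(p0 * x + p1 * y) by linarith]; ring
    have h2 : (p0 * x + p1 * y) ^ 2 ≤ (p0 ^ 2 + p1 ^ 2) * (x ^ 2 + y ^ 2) := by
      nlinarith [sq_nonneg (p0 * y - p1 * x)]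
    have h3 : p0 ^ 2 + p1 ^ 2 = 1 - p2 ^ 2 := by linarith
    rw [h3] at h2
    nlinarith
  have hne : 0 < x ^ 2 + y ^ 2 + z ^ 2 ∨ 0 < u.2 ^ 2 := by
    by_contra! h
    refine hu (Prod.ext ?_ ?_)
    · ext i
      fin_cases i
      · exact pow_eq_zero_iff two_ne_zero |>.1 (show x ^ 2 = 0 by nlinarith [h.1])
      · exact pow_eq_zero_iff two_ne_zero |>.1 (show y ^ 2 = 0 by nlinarith [h.1])
      · exact pow_eq_zero_iff two_ne_zero |>.1 (show z ^ 2 = 0 by nlinarith [h.1])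
    · exact pow_eq_zero_iff two_ne_zero |>.1 (show u.2 ^ 2 = 0 by nlinarith [h.2])
  -- The lower bound is `a` when `b ≥ 0` and `a + b (1 - p2²)` when `b < 0`.
  obtain ⟨m, hm, hmle⟩ : ∃ m, 0 < m ∧
      m * (x ^ 2 + y ^ 2 + z ^ 2) ≤ a * (x ^ 2 + y ^ 2 + z ^ 2) + b * z ^ 2 := by
    rcases le_or_gt 0 b with hb | hb
    · exact ⟨a, ha, by nlinarith [mul_nonneg hb (sq_nonneg z)]⟩
    · exact ⟨_, hab, by nlinarith [mul_le_mul_of_nonpos_left hz hb.le]⟩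
  have e : a * (x * x + y * y + z * z) + b * (z * z) + c * (u.2 * u.2) =
      (a * (x ^ 2 + y ^ 2 + z ^ 2) + b * z ^ 2) + c * u.2 ^ 2 := by ring
  rw [e]
  have h5 : 0 ≤ m * (x ^ 2 + y ^ 2 + z ^ 2) := by positivity
  have h6 : 0 ≤ c * u.2 ^ 2 := by positivity
  rcases hne with h | h
  · have := mul_pos hm h; linarith
  · have := mul_pos hc h; linarith

/-- The third coordinate on the sphere. -/
def height (p : S2 × ℝ) : ℝ := (p.1 : EuclideanSpace ℝ (Fin 3)) 2

theorem contMDiff_height : ContMDiff modelS2R 𝓘(ℝ, ℝ) ∞ height :=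
  ((EuclideanSpace.proj (2 : Fin 3) : EuclideanSpace ℝ (Fin 3) →L[ℝ] ℝ).contDiff.contMDiff).comp
    (contMDiff_coe_sphere.comp contMDiff_fst)

theorem height_mem_Icc (p : S2 × ℝ) : height p ∈ Icc (-1) 1 := by
  have h := p.1.2
  rw [mem_sphere_zero_iff_norm] at h
  have h2 := PiLp.norm_apply_le (p.1 : EuclideanSpace ℝ (Fin 3)) 2
  rw [h] at h2
  exact abs_le.1 h2

/-- The metric `A ⟨dP, dP⟩ + B dP₃² + C dz²` on `S² × ℝ`, with `A`, `B`, `C` functions of the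
height. -/
def heightMetric {A B C : ℝ → ℝ} (hA : ContDiffOn ℝ ∞ A (Icc (-1) 1))
    (hB : ContDiffOn ℝ ∞ B (Icc (-1) 1)) (hC : ContDiffOn ℝ ∞ C (Icc (-1) 1))
    (hApos : ∀ t ∈ Icc (-1 : ℝ) 1, 0 < A t) (hCpos : ∀ t ∈ Icc (-1 : ℝ) 1, 0 < C t)
    (hAB : ∀ t ∈ Icc (-1 : ℝ) 1, 0 < A t + B t * (1 - t ^ 2)) : SmoothMetricS2R where
  inner := pullbackForm modelS2R ambient
    fun p => ambientForm (A (height p)) (B (height p)) (C (height p))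
  symm p v w := by
    simp only [pullbackForm_apply, ambientForm_apply]; ring
  pos p v hv := by
    rw [pullbackForm_apply]
    refine ambientForm_pos (P := p.1) (hApos _ (height_mem_Icc p)) (hCpos _ (height_mem_Icc p))
      (hAB _ (height_mem_Icc p)) (fun h => hv ?_) (inner_mvfderiv_ambient p v)
    exact injective_mvfderiv_ambient p (h.trans (map_zero _).symm)
  isVonNBounded p := by
    refine isVonNBounded_of_posDef (E := EuclideanSpace ℝ (Fin 2) × ℝ)
      (pullbackForm modelS2R ambient
        (fun p => ambientForm (A (height p)) (B (height p)) (C (height p))) p) fun v hv => ?_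
    refine ambientForm_pos (P := p.1) (hApos _ (height_mem_Icc p)) (hCpos _ (height_mem_Icc p))
      (hAB _ (height_mem_Icc p)) (fun h => hv ?_) (inner_mvfderiv_ambient p v)
    exact injective_mvfderiv_ambient p (h.trans (map_zero _).symm)
  contMDiff := by
    refine contMDiff_pullbackForm contMDiff_ambient ?_
    have hc : ∀ {f : ℝ → ℝ}, ContDiffOn ℝ ∞ f (Icc (-1) 1) →
        ContMDiff modelS2R 𝓘(ℝ, ℝ) ∞ fun p => f (height p) := fun hf =>
      hf.contMDiffOn.comp_contMDiff contMDiff_height height_mem_Icc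
    exact contDiff_ambientForm.contMDiff.comp
      ((hc hA).prodMk_space ((hc hB).prodMk_space (hc hC)))

theorem heightMetric_polarParam {A B C : ℝ → ℝ} (hA : ContDiffOn ℝ ∞ A (Icc (-1) 1))
    (hB : ContDiffOn ℝ ∞ B (Icc (-1) 1)) (hC : ContDiffOn ℝ ∞ C (Icc (-1) 1))
    (hApos : ∀ t ∈ Icc (-1 : ℝ) 1, 0 < A t) (hCpos : ∀ t ∈ Icc (-1 : ℝ) 1, 0 < C t)
    (hAB : ∀ t ∈ Icc (-1 : ℝ) 1, 0 < A t + B t * (1 - t ^ 2)) {α : ℝ → ℝ} {a : ℝ}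
    {p : ℝ × ℝ × ℝ} (hα : HasDerivAt α a p.1) (v w : ℝ × ℝ × ℝ) :
    (heightMetric hA hB hC hApos hCpos hAB).inner (polarParam α p)
        (mfderiv 𝓘(ℝ, ℝ × ℝ × ℝ) modelS2R (polarParam α) p v)
        (mfderiv 𝓘(ℝ, ℝ × ℝ × ℝ) modelS2R (polarParam α) p w) =
      (A (cos (α p.1)) + B (cos (α p.1)) * sin (α p.1) ^ 2) * a ^ 2 * (v.1 * w.1) +
      A (cos (α p.1)) * sin (α p.1) ^ 2 * (v.2.1 * w.2.1) + C (cos (α p.1)) * (v.2.2 * w.2.2) := by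
  have hh : height (polarParam α p) = cos (α p.1) := by
    simp [height, polarParam, spherePoint]
  simp only [heightMetric, pullbackForm_apply, hh]
  rw [mvfderiv_ambient_mfderiv_polarParam hα, mvfderiv_ambient_mfderiv_polarParam hα,
    ambientForm_apply]
  simp only [Matrix.cons_val_zero, Matrix.cons_val_one, Matrix.cons_val]
  have h1 := sin_sq_add_cos_sq (α p.1)
  have h2 := sin_sq_add_cos_sq p.2.1
  have h3 : cos (α p.1) ^ 2 = 1 - sin (α p.1) ^ 2 := by linarith
  have h4 : cos p.2.1 ^ 2 = 1 - sin p.2.1 ^ 2 := by linarith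
  ring_nf
  simp only [h3, h4]
  ring

end ConstructMetric

/-! ### Coefficients built from `θ`, near one pole and then globally -/

section Coefficients

theorem exists_coefficients_left {b : ℝ} (hb : 0 < b) {θ : ℝ → ℝ}
    (hθ : ContDiffOn ℝ ∞ θ (Icc 0 b)) (h1 : derivWithin θ (Icc 0 b) 0 = 1)
    (heven : ∀ k : ℕ, iteratedDerivWithin (2 * k) θ (Icc 0 b) 0 = 0) :
    ∃ A B C : ℝ → ℝ, (ContDiffOn ℝ ∞ A (Ioc (-1) 1) ∧ ContDiffOn ℝ ∞ B (Ioc (-1) 1) ∧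
      ContDiffOn ℝ ∞ C (Ioc (-1) 1)) ∧ ∀ r ∈ Ico 0 π,
        A (cos r) * sin r ^ 2 = sin (θ (b / π * r)) ^ 2 ∧
        A (cos r) + B (cos r) * sin r ^ 2 = (b / π) ^ 2 ∧
        C (cos r) = cos (θ (b / π * r)) ^ 2 := by
  have hπ := pi_pos
  set c := b / π with hc
  have hc0 : 0 < c := div_pos hb hπ
  have hΘ := smoothParityOn_reflectExt hb hθ heven
  have hθ0 : θ 0 = 0 := by simpa using heven 0
  have hmem : ∀ r ∈ Ioo (-π) π, c * r ∈ Ioo (-b) b := by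
    intro r hr
    have e : c * π = b := by rw [hc]; field_simp
    rw [← e]
    exact ⟨by nlinarith [hr.1], by nlinarith [hr.2]⟩
  have hT : SmoothParityOn π (-1) (fun r => reflectExt (-1) θ (c * r)) :=
    ⟨hΘ.smooth.comp (contDiff_const.mul contDiff_id).contDiffOn hmem, fun r hr => by
      rw [mul_neg, hΘ.parity _ (hmem r hr)]⟩
  have hz : (0 : ℝ) ∈ Ioo (-π) π := ⟨by linarith, hπ⟩
  have hdT : HasDerivAt (fun r => reflectExt (-1) θ (c * r)) c 0 := by
    have h := hasDerivAt_reflectExt hb (.inr rfl) hθ (fun _ => hθ0) (fun h => by norm_num at h)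
      (x := c * 0) (hmem 0 hz)
    have h' := HasDerivAt.comp (h₂ := reflectExt (-1) θ) (h := fun r => c * r) 0 h
      ((hasDerivAt_id (0 : ℝ)).const_mul c)
    refine h'.congr_deriv ?_
    simp [reflectExt, h1]
  have hU : SmoothParityOn π (-1) (fun r => sin (reflectExt (-1) θ (c * r))) :=
    ⟨contDiff_sin.comp_contDiffOn hT.smooth, fun r hr => by rw [hT.parity r hr]; simp⟩
  have hV : SmoothParityOn π 1 (fun r => cos (reflectExt (-1) θ (c * r))) :=
    ⟨contDiff_cos.comp_contDiffOn hT.smooth, fun r hr => by rw [hT.parity r hr]; simp⟩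
  have hT0 : reflectExt (-1) θ (c * 0) = 0 := by simp [reflectExt, hθ0]
  obtain ⟨q, hq, hq0, hUq⟩ := hU.exists_eq_sin_mul (by simp only [hT0, sin_zero])
  -- The unit slope of `θ` enters here: it gives `q 0 = b / π`, so that `c² - q²` vanishes at the
  -- pole.
  rw [hdT.sin.deriv, hT0, cos_zero, one_mul] at hq0
  rw [neg_neg] at hq
  have hD : SmoothParityOn π 1 (fun r => c ^ 2 - q r * q r) :=
    ⟨contDiffOn_const.sub (hq.smooth.mul hq.smooth), fun r hr => by rw [hq.parity r hr]; ring⟩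
  have hD0 : c ^ 2 - q 0 * q 0 = 0 := by rw [hq0]; ring
  obtain ⟨h, hh, hh0, hDh⟩ := hD.exists_eq_sin_mul hD0
  -- The first quotient is odd, so it vanishes at `0` and a second factor `sin r` splits off.
  have hh0' : h 0 = 0 := by
    have := hh.parity 0 hz
    rw [neg_zero] at this; linarith
  obtain ⟨B, hB, -, hhB⟩ := hh.exists_eq_sin_mul hh0'
  rw [neg_neg] at hB
  have hA := hq.mul hq
  have hC := hV.mul hV
  rw [one_mul] at hA hC
  refine ⟨_, _, _, ⟨hA.contDiffOn_comp_arccos, hB.contDiffOn_comp_arccos,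
    hC.contDiffOn_comp_arccos⟩, fun r hr => ?_⟩
  have hr' : r ∈ Ioo (-π) π := ⟨by linarith [hr.1], hr.2⟩
  have e : reflectExt (-1) θ (c * r) = θ (c * r) := if_pos (mul_nonneg hc0.le hr.1)
  have e1 := hUq r hr'
  have e2 := hDh r hr'
  rw [e] at e1
  simp only [arccos_cos hr.1 hr.2.le, e]
  refine ⟨?_, ?_, by ring⟩
  · rw [e1]; ring
  · rw [hhB r hr'] at e2
    linarith

theorem exists_contDiffOn_Icc_of_Ioc_of_Ico {f g : ℝ → ℝ} (hf : ContDiffOn ℝ ∞ f (Ioc (-1) 1))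
    (hg : ContDiffOn ℝ ∞ g (Ico (-1) 1)) (hfg : ∀ t ∈ Ioo (-1 : ℝ) 1, f t = g t) :
    ∃ F : ℝ → ℝ, ContDiffOn ℝ ∞ F (Icc (-1) 1) ∧ (∀ t ∈ Ioc (-1 : ℝ) 1, F t = f t) ∧
      ∀ t ∈ Ico (-1 : ℝ) 1, F t = g t := by
  have hF1 : ∀ t ∈ Ioc (-1 : ℝ) 1, (if 0 < t then f t else g t) = f t := by
    intro t ht
    split_ifs with h
    · rfl
    · exact (hfg t ⟨ht.1, by linarith⟩).symm
  have hF2 : ∀ t ∈ Ico (-1 : ℝ) 1, (if 0 < t then f t else g t) = g t := by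
    intro t ht
    split_ifs with h
    · exact hfg t ⟨by linarith, ht.2⟩
    · rfl
  refine ⟨fun t => if 0 < t then f t else g t, fun t ht => ?_, hF1, hF2⟩
  rcases eq_or_lt_of_le ht.1 with rfl | h
  · refine ((hg.congr hF2) (-1) ⟨le_rfl, by norm_num⟩).mono_of_mem_nhdsWithin ?_
    filter_upwards [self_mem_nhdsWithin, mem_nhdsWithin_of_mem_nhds
      (Iio_mem_nhds (show (-1 : ℝ) < 1 by norm_num))] with x hx hx'
    exact ⟨hx.1, hx'⟩
  · refine ((hf.congr hF1) t ⟨h, ht.2⟩).mono_of_mem_nhdsWithin ?_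
    filter_upwards [self_mem_nhdsWithin, mem_nhdsWithin_of_mem_nhds (Ioi_mem_nhds h)]
      with x hx hx'
    exact ⟨hx', hx.2⟩

theorem exists_coefficients {b : ℝ} (hb : 0 < b) {θ : ℝ → ℝ}
    (hθ : ContDiffOn ℝ ∞ θ (Icc 0 b)) (h0 : derivWithin θ (Icc 0 b) 0 = 1)
    (h0even : ∀ k : ℕ, iteratedDerivWithin (2 * k) θ (Icc 0 b) 0 = 0)
    (h1 : derivWithin (fun x => θ (b - x)) (Icc 0 b) 0 = 1)
    (h1even : ∀ k : ℕ, iteratedDerivWithin (2 * k) (fun x => θ (b - x)) (Icc 0 b) 0 = 0) :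
    ∃ A B C : ℝ → ℝ, (ContDiffOn ℝ ∞ A (Icc (-1) 1) ∧ ContDiffOn ℝ ∞ B (Icc (-1) 1) ∧
      ContDiffOn ℝ ∞ C (Icc (-1) 1)) ∧ ∀ r ∈ Icc 0 π,
        A (cos r) * sin r ^ 2 = sin (θ (b / π * r)) ^ 2 ∧
        A (cos r) + B (cos r) * sin r ^ 2 = (b / π) ^ 2 ∧
        C (cos r) = cos (θ (b / π * r)) ^ 2 := by
  have hθ' : ContDiffOn ℝ ∞ (fun x => θ (b - x)) (Icc 0 b) :=
    hθ.comp (contDiff_const.sub contDiff_id).contDiffOn fun x hx =>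
      ⟨by simpa using hx.2, by simpa using hx.1⟩
  obtain ⟨A₁, B₁, C₁, ⟨hA₁, hB₁, hC₁⟩, h₁⟩ := exists_coefficients_left hb hθ h0 h0even
  obtain ⟨A₂, B₂, C₂, ⟨hA₂, hB₂, hC₂⟩, h₂⟩ := exists_coefficients_left hb hθ' h1 h1even
  have h₂' : ∀ r ∈ Ioc 0 π, A₂ (-cos r) * sin r ^ 2 = sin (θ (b / π * r)) ^ 2 ∧
        A₂ (-cos r) + B₂ (-cos r) * sin r ^ 2 = (b / π) ^ 2 ∧
        C₂ (-cos r) = cos (θ (b / π * r)) ^ 2 := by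
    intro r hr
    -- Colatitude `π - r` measured from the south pole corresponds to `b - x`, and the height
    -- changes sign.
    have h := h₂ (π - r) ⟨by linarith [hr.2], by linarith [hr.1]⟩
    rwa [cos_pi_sub, sin_pi_sub,
      show b - b / π * (π - r) = b / π * r by field_simp; ring] at h
  have hcos : ∀ t ∈ Ioo (-1 : ℝ) 1, ∃ r ∈ Ioo 0 π, cos r = t := fun t ht =>
    ⟨arccos t, ⟨arccos_pos.2 ht.2, arccos_lt_pi.2 ht.1⟩, cos_arccos ht.1.le ht.2.le⟩
  have hneg : ∀ {f : ℝ → ℝ}, ContDiffOn ℝ ∞ f (Ioc (-1) 1) →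
      ContDiffOn ℝ ∞ (fun t => f (-t)) (Ico (-1) 1) := fun hf =>
    hf.comp contDiff_neg.contDiffOn fun x hx => ⟨by linarith [hx.2], by linarith [hx.1]⟩
  -- Between the poles `sin r ≠ 0`, so the three equations determine the coefficients and the two
  -- local solutions agree.
  have hAeq : ∀ r ∈ Ioo 0 π, A₁ (cos r) = A₂ (-cos r) := by
    intro r hr
    have hs : 0 < sin r ^ 2 := pow_pos (sin_pos_of_pos_of_lt_pi hr.1 hr.2) 2
    refine mul_right_cancel₀ hs.ne' ?_
    rw [(h₁ r ⟨hr.1.le, hr.2⟩).1, (h₂' r ⟨hr.1, hr.2.le⟩).1]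
  obtain ⟨A, hA, hAl, hAr⟩ := exists_contDiffOn_Icc_of_Ioc_of_Ico hA₁ (hneg hA₂) (by
    intro t ht
    obtain ⟨r, hr, rfl⟩ := hcos t ht
    exact hAeq r hr)
  obtain ⟨B, hB, hBl, hBr⟩ := exists_contDiffOn_Icc_of_Ioc_of_Ico hB₁ (hneg hB₂) (by
    intro t ht
    obtain ⟨r, hr, rfl⟩ := hcos t ht
    have hs : 0 < sin r ^ 2 := pow_pos (sin_pos_of_pos_of_lt_pi hr.1 hr.2) 2
    refine mul_right_cancel₀ hs.ne' ?_
    have e1 := (h₁ r ⟨hr.1.le, hr.2⟩).2.1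
    have e2 := (h₂' r ⟨hr.1, hr.2.le⟩).2.1
    rw [hAeq r hr] at e1
    linarith)
  obtain ⟨C, hC, hCl, hCr⟩ := exists_contDiffOn_Icc_of_Ioc_of_Ico hC₁ (hneg hC₂) (by
    intro t ht
    obtain ⟨r, hr, rfl⟩ := hcos t ht
    exact (h₁ r ⟨hr.1.le, hr.2⟩).2.2.trans (h₂' r ⟨hr.1, hr.2.le⟩).2.2.symm)
  refine ⟨A, B, C, ⟨hA, hB, hC⟩, fun r hr => ?_⟩
  rcases eq_or_lt_of_le hr.2 with rfl | hlt
  · have hm : cos π ∈ Ico (-1 : ℝ) 1 := by rw [cos_pi]; exact ⟨le_rfl, by norm_num⟩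
    rw [hAr _ hm, hBr _ hm, hCr _ hm]
    exact h₂' π ⟨pi_pos, le_rfl⟩
  · have hm : cos r ∈ Ioc (-1 : ℝ) 1 :=
      ⟨by rw [← cos_pi]; exact cos_lt_cos_of_nonneg_of_le_pi hr.1 le_rfl hlt, cos_le_one r⟩
    rw [hAl _ hm, hBl _ hm, hCl _ hm]
    exact h₁ r ⟨hr.1, hlt⟩

end Coefficients

theorem isColatitude_linear {b : ℝ} (hb : 0 < b) : IsColatitude b (fun x => π / b * x) where
  continuousOn := by fun_prop
  contDiffOn := (contDiff_const.mul contDiff_id).contDiffOn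
  deriv_pos x _ := by
    have h : HasDerivAt (fun x => π / b * x) (π / b) x := by
      simpa using (hasDerivAt_id x).const_mul (π / b)
    rw [h.deriv]; exact div_pos pi_pos hb
  left := by simp
  right := by field_simp

theorem definesSmoothMetricOnS2R_of_coefficients {b : ℝ} (hb : 0 < b) {θ A B C : ℝ → ℝ}
    (hθ : ∀ x ∈ Ioo 0 b, sin (θ x) ≠ 0) (hθ' : ∀ x ∈ Icc 0 b, cos (θ x) ≠ 0)
    (hA : ContDiffOn ℝ ∞ A (Icc (-1) 1)) (hB : ContDiffOn ℝ ∞ B (Icc (-1) 1))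
    (hC : ContDiffOn ℝ ∞ C (Icc (-1) 1)) (h : ∀ r ∈ Icc 0 π,
        A (cos r) * sin r ^ 2 = sin (θ (b / π * r)) ^ 2 ∧
        A (cos r) + B (cos r) * sin r ^ 2 = (b / π) ^ 2 ∧
        C (cos r) = cos (θ (b / π * r)) ^ 2) :
    DefinesSmoothMetricOnS2R b θ := by
  have hπ := pi_pos
  have hc0 : 0 < b / π := div_pos hb hπ
  have hcos : ∀ t ∈ Icc (-1 : ℝ) 1, ∃ r ∈ Icc 0 π, cos r = t := fun t ht =>
    ⟨arccos t, ⟨arccos_nonneg t, arccos_le_pi t⟩, cos_arccos ht.1 ht.2⟩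
  have e : b / π * π = b := by field_simp
  have hApos : ∀ t ∈ Icc (-1 : ℝ) 1, 0 < A t := by
    intro t ht
    obtain ⟨r, hr, rfl⟩ := hcos t ht
    obtain ⟨e1, e2, -⟩ := h r hr
    -- At a pole `A` equals `(b / π)²`; elsewhere its sign is that of `sin² θ`.
    by_cases hs : sin r = 0
    · rw [hs] at e2
      have := pow_pos hc0 2
      linarith
    · have hr1 : r ∈ Ioo 0 π := by
        refine ⟨lt_of_le_of_ne hr.1 ?_, lt_of_le_of_ne hr.2 ?_⟩
        · rintro rfl; exact hs sin_zero
        · rintro rfl; exact hs sin_pi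
      have hx : b / π * r ∈ Ioo 0 b :=
        ⟨mul_pos hc0 hr1.1, by nlinarith [mul_lt_mul_of_pos_left hr1.2 hc0]⟩
      have hpos : 0 < A (cos r) * sin r ^ 2 := by
        rw [e1]; exact sq_pos_of_ne_zero (hθ _ hx)
      exact (pos_iff_pos_of_mul_pos hpos).2 (by positivity)
  have hCpos : ∀ t ∈ Icc (-1 : ℝ) 1, 0 < C t := by
    intro t ht
    obtain ⟨r, hr, rfl⟩ := hcos t ht
    rw [(h r hr).2.2]
    have hx : b / π * r ∈ Icc 0 b :=
      ⟨mul_nonneg hc0.le hr.1, by nlinarith [mul_le_mul_of_nonneg_left hr.2 hc0.le]⟩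
    have := hθ' _ hx
    positivity
  have hAB : ∀ t ∈ Icc (-1 : ℝ) 1, 0 < A t + B t * (1 - t ^ 2) := by
    intro t ht
    obtain ⟨r, hr, rfl⟩ := hcos t ht
    rw [← sin_sq, (h r hr).2.1]
    positivity
  refine ⟨fun x => π / b * x, isColatitude_linear hb,
    heightMetric hA hB hC hApos hCpos hAB, fun p hp v w => ?_⟩
  have hα : HasDerivAt (fun x => π / b * x) (π / b) p.1 := by
    simpa using (hasDerivAt_id p.1).const_mul (π / b)
  have hr : π / b * p.1 ∈ Icc 0 π := by
    have e' : π / b * b = π := by field_simp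
    have hd : 0 < π / b := div_pos hπ hb
    exact ⟨mul_nonneg hd.le hp.1.le, by nlinarith [mul_le_mul_of_nonneg_left hp.2.le hd.le]⟩
  obtain ⟨e1, e2, e3⟩ := h _ hr
  rw [heightMetric_polarParam hA hB hC hApos hCpos hAB hα, e1, e2, e3, warpedForm,
    show b / π * (π / b * p.1) = p.1 by field_simp]
  field_simp

/-! ### Derivatives of `θ` at an endpoint from the metric components -/

section Endpoint

/-- The even functions `e` and `m` stand for the radial and angular components of the metric;
leaving them abstract lets the same argument serve both poles. -/
theorem endpoint_derivatives {b : ℝ} (hb : 0 < b) {θ α e m : ℝ → ℝ}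
    (hθ : ContDiffOn ℝ ∞ θ (Icc 0 b)) (hθmem : ∀ x ∈ Ioo 0 b, θ x ∈ Ioo 0 (π / 2))
    (hα0 : Filter.Tendsto α (nhdsWithin 0 (Ioi 0)) (nhds 0))
    (hα : ∀ x ∈ Ioo 0 b, DifferentiableAt ℝ α x) (hα' : ∀ x ∈ Ioo 0 b, 0 < deriv α x)
    (hαmem : ∀ x ∈ Ioo 0 b, α x ∈ Ioo 0 π)
    (he : SmoothParityOn π 1 e) (hm : SmoothParityOn π 1 m)
    (hepos : ∀ r ∈ Ioo (-π) π, 0 < e r) (hmpos : ∀ r ∈ Ioo (-π) π, 0 < m r) (hme : m 0 = e 0)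
    (hαe : ∀ x ∈ Ioo 0 b, deriv α x ^ 2 * e (α x) = 1)
    (hθm : ∀ x ∈ Ioo 0 b, sin (θ x) ^ 2 = sin (α x) ^ 2 * m (α x)) :
    derivWithin θ (Icc 0 b) 0 = 1 ∧ ∀ k : ℕ, iteratedDerivWithin (2 * k) θ (Icc 0 b) 0 = 0 := by
  have hπ := pi_pos
  have hz : (0 : ℝ) ∈ Ioo (-π) π := ⟨by linarith, hπ⟩
  have hκ : SmoothParityOn π 1 (fun r => (√(e r))⁻¹) :=
    ⟨(he.smooth.sqrt fun r hr => (hepos r hr).ne').inv fun r hr => (sqrt_pos.2 (hepos r hr)).ne',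
      fun r hr => by simp only [he.parity r hr, one_mul]⟩
  have hsm : SmoothParityOn π (-1) (fun r => sin r * √(m r)) :=
    ⟨contDiff_sin.contDiffOn.mul (hm.smooth.sqrt fun r hr => (hmpos r hr).ne'),
      fun r hr => by simp only [hm.parity r hr, one_mul, sin_neg]; ring⟩
  -- `arcsin` is smooth only away from `±1`, so work where its argument stays inside `(-1, 1)`.
  obtain ⟨ε, hε, hεπ, hε1⟩ : ∃ ε, 0 < ε ∧ ε ≤ π ∧
      ∀ r ∈ Ioo (-ε) ε, sin r * √(m r) ∈ Ioo (-1 : ℝ) 1 := by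
    have hn : Ioo (-1 : ℝ) 1 ∈ nhds (sin 0 * √(m 0)) := by
      rw [sin_zero, zero_mul]; exact Ioo_mem_nhds (by norm_num) (by norm_num)
    obtain ⟨ε, hε, h⟩ := Metric.mem_nhds_iff.1 ((hsm.continuousAt hz).preimage_mem_nhds hn)
    refine ⟨min ε π, lt_min hε hπ, min_le_right _ _, fun r hr => h ?_⟩
    rw [Metric.mem_ball, dist_zero_right, norm_eq_abs]
    exact (abs_lt.2 hr).trans_le (min_le_left _ _)
  have hsmε := hsm.mono hεπ
  have hψ : SmoothParityOn ε (-1) (fun r => arcsin (sin r * √(m r))) := by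
    refine ⟨fun r hr => ?_, fun r hr => ?_⟩
    · have h1 := hε1 r hr
      exact ContDiffAt.comp_contDiffWithinAt (g := arcsin) r (contDiffAt_arcsin h1.1.ne' h1.2.ne)
        (hsmε.smooth r hr)
    · simp only [hsmε.parity r hr, neg_one_mul, arcsin_neg]
  obtain ⟨δ, hδ, hδb, hδα⟩ : ∃ δ, 0 < δ ∧ δ ≤ b ∧ ∀ x ∈ Ioo 0 δ, α x ∈ Ioo (-ε) ε := by
    have h := hα0.eventually (Ioo_mem_nhds (by linarith : -ε < 0) hε)
    obtain ⟨δ, hδ, h⟩ := mem_nhdsGT_iff_exists_Ioo_subset.1 h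
    refine ⟨min δ b, lt_min hδ hb, min_le_right _ _, fun x hx => h ⟨hx.1, ?_⟩⟩
    exact hx.2.trans_le (min_le_left _ _)
  have hsub : ∀ x ∈ Ioo 0 δ, x ∈ Ioo 0 b := fun x hx => ⟨hx.1, hx.2.trans_le hδb⟩
  have hflow : ∀ x ∈ Ioo 0 δ, HasDerivAt α ((√(e (α x)))⁻¹) x := by
    intro x hx
    have hx := hsub x hx
    refine (hα x hx).hasDerivAt.congr_deriv ?_
    have h1 := hαe x hx
    have h2 : e (α x) = (deriv α x)⁻¹ ^ 2 := by
      have := (hα' x hx).ne'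
      field_simp
      linarith
    rw [h2, sqrt_sq (inv_nonneg.2 (hα' x hx).le), inv_inv]
  have hθψ : ∀ x ∈ Ioo 0 δ, θ x = arcsin (sin (α x) * √(m (α x))) := by
    intro x hx
    have hx := hsub x hx
    have h1 := hθmem x hx
    have h2 := hαmem x hx
    have h3 : 0 < m (α x) := hmpos _ ⟨by linarith [h2.1], h2.2⟩
    have h4 : sin (θ x) = sin (α x) * √(m (α x)) := by
      refine (pow_left_inj₀ (sin_nonneg_of_nonneg_of_le_pi h1.1.le (by linarith [h1.2]))
        (mul_nonneg (sin_nonneg_of_nonneg_of_le_pi h2.1.le h2.2.le) (sqrt_nonneg _))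
        two_ne_zero).1 ?_
      rw [hθm x hx, mul_pow, sq_sqrt h3.le]
    rw [← h4, arcsin_sin (by linarith [h1.1]) h1.2.le]
  have key := iteratedDerivWithin_eq_flowDeriv hδ hδb hθ hε hα0 hflow hδα (hκ.mono hεπ) hψ hθψ
  refine ⟨?_, fun k => (key (2 * k)).trans (flowDeriv_two_mul_zero hε (hκ.mono hεπ) hψ k)⟩
  have h1 := key 1
  rw [iteratedDerivWithin_one] at h1
  rw [h1]
  have hd1 : HasDerivAt (fun r => sin r * √(m r)) (√(m 0)) 0 := by
    have hs : HasDerivAt (fun r => √(m r)) _ 0 := (hm.hasDerivAt hz).sqrt (hmpos 0 hz).ne'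
    refine ((hasDerivAt_sin 0).mul hs).congr_deriv ?_
    simp
  have hd2 : HasDerivAt (fun r => arcsin (sin r * √(m r))) (√(m 0)) 0 := by
    have ha : HasDerivAt arcsin 1 (sin 0 * √(m 0)) := by
      rw [sin_zero, zero_mul]
      refine (hasDerivAt_arcsin (by norm_num) (by norm_num)).congr_deriv ?_
      simp
    exact (HasDerivAt.comp (h₂ := arcsin) 0 ha hd1).congr_deriv (one_mul _)
  -- The first flow derivative is `ψ'(0) κ(0)`, and `m 0 = e 0` makes it `1`.
  change deriv (fun r => arcsin (sin r * √(m r))) 0 * (√(e 0))⁻¹ = 1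
  rw [hd2.deriv, hme, mul_inv_cancel₀ (sqrt_pos.2 (hepos 0 hz)).ne']

end Endpoint

/-! ### Elementary properties of admissible colatitudes -/

section Colatitude

variable {b : ℝ} {α : ℝ → ℝ}

theorem IsColatitude.strictMonoOn (h : IsColatitude b α) : StrictMonoOn α (Icc 0 b) := by
  refine strictMonoOn_of_deriv_pos (convex_Icc 0 b) h.continuousOn fun x hx => ?_
  rw [interior_Icc] at hx
  exact h.deriv_pos x hx

theorem IsColatitude.mem_Ioo (h : IsColatitude b α) {x : ℝ} (hx : x ∈ Ioo 0 b) :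
    α x ∈ Ioo 0 π := by
  have hb : 0 ≤ b := (hx.1.trans hx.2).le
  have hx' := Ioo_subset_Icc_self hx
  constructor
  · rw [← h.left]; exact h.strictMonoOn (left_mem_Icc.2 hb) hx' hx.1
  · rw [← h.right]; exact h.strictMonoOn hx' (right_mem_Icc.2 hb) hx.2

theorem IsColatitude.exists_eq (h : IsColatitude b α) (hb : 0 < b) {r : ℝ} (hr : r ∈ Ioo 0 π) :
    ∃ x ∈ Ioo 0 b, α x = r := by
  have := intermediate_value_Ioo hb.le h.continuousOn
  rw [h.left, h.right] at this
  exact this hr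

theorem IsColatitude.hasDerivAt (h : IsColatitude b α) {x : ℝ} (hx : x ∈ Ioo 0 b) :
    HasDerivAt α (deriv α x) x :=
  ((h.contDiffOn.differentiableOn (by simp)).differentiableAt (isOpen_Ioo.mem_nhds hx)).hasDerivAt

theorem IsColatitude.tendsto_left (h : IsColatitude b α) (hb : 0 < b) :
    Filter.Tendsto α (nhdsWithin 0 (Ioi 0)) (nhds 0) := by
  have hc := h.continuousOn 0 (left_mem_Icc.2 hb.le)
  rw [ContinuousWithinAt, h.left] at hc
  refine hc.mono_left ?_
  rw [← nhdsWithin_Ioo_eq_nhdsGT hb]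
  exact nhdsWithin_mono _ Ioo_subset_Icc_self

theorem IsColatitude.reflect (h : IsColatitude b α) : IsColatitude b (fun x => π - α (b - x)) where
  continuousOn := continuousOn_const.sub (h.continuousOn.comp (by fun_prop) fun x hx =>
    ⟨by linarith [hx.2], by linarith [hx.1]⟩)
  contDiffOn := contDiffOn_const.sub (h.contDiffOn.comp
    (contDiff_const.sub contDiff_id).contDiffOn fun x hx => by
      simpa [and_comm] using hx)
  deriv_pos x hx := by
    have hx' : b - x ∈ Ioo 0 b := ⟨by linarith [hx.2], by linarith [hx.1]⟩
    rw [deriv_const_sub, deriv_comp_const_sub, neg_neg]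
    exact h.deriv_pos _ hx'
  left := by simp [h.right]
  right := by simp [h.left]

end Colatitude

/-! ### A parametrization of the sphere that is regular at the poles -/

section GreatCircles

/-- The rotations of the meridian circle of longitude `0` along the great circles orthogonal to
it. -/
def orthogonalParam (q : ℝ × ℝ) : S2 × ℝ :=
  (⟨!₂[cos q.2 * sin q.1, sin q.2, cos q.2 * cos q.1], by
    rw [mem_sphere_zero_iff_norm, EuclideanSpace.norm_eq, Real.sqrt_eq_one]
    simp only [Real.norm_eq_abs, sq_abs, Fin.sum_univ_three]
    simp
    nlinarith [sin_sq_add_cos_sq q.1, sin_sq_add_cos_sq q.2]⟩, 0)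

theorem contMDiff_orthogonalParam : ContMDiff 𝓘(ℝ, ℝ × ℝ) modelS2R ∞ orthogonalParam := by
  have h : ContMDiff 𝓘(ℝ, ℝ × ℝ) 𝓘(ℝ, EuclideanSpace ℝ (Fin 3)) ∞
      (fun q : ℝ × ℝ => ((orthogonalParam q).1 : EuclideanSpace ℝ (Fin 3))) := by
    rw [contMDiff_iff_contDiff, contDiff_euclidean]
    intro i
    fin_cases i <;> simp [orthogonalParam] <;> fun_prop
  exact (h.codRestrict_sphere fun q => (orthogonalParam q).1.2).prodMk contMDiff_const

theorem mvfderiv_ambient_mfderiv_orthogonalParam (q v : ℝ × ℝ) :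
    mvfderiv modelS2R ambient (orthogonalParam q)
      (mfderiv 𝓘(ℝ, ℝ × ℝ) modelS2R orthogonalParam q v) =
      (!₂[cos q.2 * (cos q.1 * v.1) - sin q.2 * v.2 * sin q.1, cos q.2 * v.2,
        -(cos q.2 * (sin q.1 * v.1)) - sin q.2 * v.2 * cos q.1], 0) := by
  refine mvfderiv_ambient_mfderiv
    ((contMDiff_orthogonalParam q).mdifferentiableAt (by simp)) ?_
  have hlin : ∀ c d : ℝ, HasDerivAt (fun t : ℝ => c + t * d) d 0 := fun c d => by
    simpa using ((hasDerivAt_id (0 : ℝ)).mul_const d).const_add c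
  have hs : HasDerivAt (fun t : ℝ => sin (q.1 + t * v.1)) _ 0 := (hlin q.1 v.1).sin
  have hc : HasDerivAt (fun t : ℝ => cos (q.1 + t * v.1)) _ 0 := (hlin q.1 v.1).cos
  have hs2 : HasDerivAt (fun t : ℝ => sin (q.2 + t * v.2)) _ 0 := (hlin q.2 v.2).sin
  have hc2 : HasDerivAt (fun t : ℝ => cos (q.2 + t * v.2)) _ 0 := (hlin q.2 v.2).cos
  refine ((hasDerivAt_euclidean_three (hc2.mul hs) hs2 (hc2.mul hc)).prodMk
    (hasDerivAt_const (0 : ℝ) (0 : ℝ))).congr_deriv ?_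
  simp only [zero_mul, add_zero]
  refine Prod.ext ?_ rfl
  ext i
  fin_cases i <;> simp <;> ring

/-- The squared length, in the metric `g`, of the velocity of `orthogonalParam` at `q` in the
direction `v`. -/
def orthogonalNormSq (g : SmoothMetricS2R) (v q : ℝ × ℝ) : ℝ :=
  g.inner (orthogonalParam q) (mfderiv 𝓘(ℝ, ℝ × ℝ) modelS2R orthogonalParam q v)
    (mfderiv 𝓘(ℝ, ℝ × ℝ) modelS2R orthogonalParam q v)

theorem contDiff_orthogonalNormSq (g : SmoothMetricS2R) (v : ℝ × ℝ) :
    ContDiff ℝ ∞ (orthogonalNormSq g v) :=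
  contDiff_metric_mfderiv g.contMDiff contMDiff_orthogonalParam v

/-- Compares velocities of different parametrizations at the same point through their ambient
images; the equality `P = Q` is kept as a hypothesis because the tangent spaces are dependent types.
-/
theorem inner_self_eq_of_ambient_eq (g : SmoothMetricS2R) {P Q : S2 × ℝ} (hPQ : P = Q)
    {u : TangentSpace modelS2R P} {w : TangentSpace modelS2R Q} {k : ℝ}
    (h : mvfderiv modelS2R ambient P u = k • mvfderiv modelS2R ambient Q w) :
    g.inner P u u = k ^ 2 * g.inner Q w w := by
  subst hPQ
  have : u = k • w := injective_mvfderiv_ambient P (h.trans (map_smul _ _ _).symm)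
  rw [this]
  simp only [map_smul, smul_apply, smul_eq_mul]
  ring

theorem orthogonalNormSq_pos (g : SmoothMetricS2R) {v q : ℝ × ℝ}
    (h : mvfderiv modelS2R ambient (orthogonalParam q)
      (mfderiv 𝓘(ℝ, ℝ × ℝ) modelS2R orthogonalParam q v) ≠ 0) : 0 < orthogonalNormSq g v q :=
  g.pos _ _ fun h0 => h (by rw [h0, map_zero])

theorem orthogonalNormSq_radial_pos (g : SmoothMetricS2R) (r : ℝ) :
    0 < orthogonalNormSq g (1, 0) (r, 0) := by
  refine orthogonalNormSq_pos g fun h => ?_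
  rw [mvfderiv_ambient_mfderiv_orthogonalParam] at h
  have h0 := congrArg (fun u : AmbientSpace => u.1 0) h
  have h2 := congrArg (fun u : AmbientSpace => u.1 2) h
  simp at h0 h2
  have := sin_sq_add_cos_sq r
  rw [h0, h2] at this
  norm_num at this

theorem orthogonalNormSq_angular_pos (g : SmoothMetricS2R) (r : ℝ) :
    0 < orthogonalNormSq g (0, 1) (r, 0) := by
  refine orthogonalNormSq_pos g fun h => ?_
  rw [mvfderiv_ambient_mfderiv_orthogonalParam] at h
  have h1 := congrArg (fun u : AmbientSpace => u.1 1) h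
  simp at h1

theorem orthogonalNormSq_periodic (g : SmoothMetricS2R) (v : ℝ × ℝ) (r t : ℝ) :
    orthogonalNormSq g v (r + 2 * π, t) = orthogonalNormSq g v (r, t) := by
  have h := inner_self_eq_of_ambient_eq g (P := orthogonalParam (r + 2 * π, t))
    (Q := orthogonalParam (r, t)) (k := 1)
    (u := mfderiv 𝓘(ℝ, ℝ × ℝ) modelS2R orthogonalParam (r + 2 * π, t) v)
    (w := mfderiv 𝓘(ℝ, ℝ × ℝ) modelS2R orthogonalParam (r, t) v)
    (by simp [orthogonalParam])
    (by simp only [mvfderiv_ambient_mfderiv_orthogonalParam, sin_add_two_pi, cos_add_two_pi,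
          one_smul])
  simpa [orthogonalNormSq] using h

end GreatCircles

/-! ### Parity and pole values of the metric components -/

section MetricComponents

variable {b : ℝ} {θ α : ℝ → ℝ} {g : SmoothMetricS2R}

/-- The metric `g` pulls back to the warped form of `θ` under the polar parametrization. -/
def PullsBackToWarpedForm (b : ℝ) (θ α : ℝ → ℝ) (g : SmoothMetricS2R) : Prop :=
  ∀ p : ℝ × ℝ × ℝ, p.1 ∈ Ioo 0 b → ∀ v w : ℝ × ℝ × ℝ,
    g.inner (polarParam α p)
      (mfderiv 𝓘(ℝ, ℝ × ℝ × ℝ) modelS2R (polarParam α) p v)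
      (mfderiv 𝓘(ℝ, ℝ × ℝ × ℝ) modelS2R (polarParam α) p w) = warpedForm θ p v w

/-- The hypotheses say coordinatewise that points agree and velocities agree up to the factor `k`.
In the applications `k` is `±α'` for meridian directions and `±sin α` for parallels, and the sign
disappears on squaring. -/
theorem warpedForm_eq_orthogonalNormSq (hg : PullsBackToWarpedForm b θ α g)
    (hα : IsColatitude b α) {x y k : ℝ} (hx : x ∈ Ioo 0 b) {v : ℝ × ℝ × ℝ} {q w : ℝ × ℝ}
    (hv : v.2.2 = 0)
    (hP0 : sin (α x) * cos y = cos q.2 * sin q.1) (hP1 : sin (α x) * sin y = sin q.2)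
    (hP2 : cos (α x) = cos q.2 * cos q.1)
    (h0 : cos (α x) * (deriv α x * v.1) * cos y - sin (α x) * (sin y * v.2.1) =
      k * (cos q.2 * (cos q.1 * w.1) - sin q.2 * w.2 * sin q.1))
    (h1 : cos (α x) * (deriv α x * v.1) * sin y + sin (α x) * (cos y * v.2.1) =
      k * (cos q.2 * w.2))
    (h2 : -(sin (α x) * (deriv α x * v.1)) =
      k * (-(cos q.2 * (sin q.1 * w.1)) - sin q.2 * w.2 * cos q.1)) :
    warpedForm θ (x, y, 0) v v = k ^ 2 * orthogonalNormSq g w q := by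
  rw [← hg (x, y, 0) hx]
  refine inner_self_eq_of_ambient_eq g ?_ ?_
  · simp [polarParam, spherePoint, orthogonalParam, hP0, hP1, hP2]
  · rw [mvfderiv_ambient_mfderiv_polarParam (hα.hasDerivAt hx),
      mvfderiv_ambient_mfderiv_orthogonalParam]
    simp only [h0, h1, h2, hv]
    refine Prod.ext ?_ (by simp)
    ext i
    fin_cases i <;> simp

theorem deriv_sq_mul_radial (hg : PullsBackToWarpedForm b θ α g) (hα : IsColatitude b α) {x : ℝ}
    (hx : x ∈ Ioo 0 b) : deriv α x ^ 2 * orthogonalNormSq g (1, 0) (α x, 0) = 1 := by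
  rw [← warpedForm_eq_orthogonalNormSq hg hα (y := 0) (v := (1, 0, 0)) hx] <;>
    simp [warpedForm]
  all_goals ring

theorem deriv_sq_mul_radial_neg (hg : PullsBackToWarpedForm b θ α g) (hα : IsColatitude b α)
    {x : ℝ} (hx : x ∈ Ioo 0 b) :
    deriv α x ^ 2 * orthogonalNormSq g (1, 0) (-α x, 0) = 1 := by
  rw [← neg_sq, ← warpedForm_eq_orthogonalNormSq hg hα (y := π) (v := (1, 0, 0)) hx] <;>
    simp [warpedForm]
  all_goals ring

theorem deriv_sq_mul_north (hg : PullsBackToWarpedForm b θ α g) (hα : IsColatitude b α) {x : ℝ}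
    (hx : x ∈ Ioo 0 b) : deriv α x ^ 2 * orthogonalNormSq g (0, 1) (0, α x) = 1 := by
  rw [← warpedForm_eq_orthogonalNormSq hg hα (y := π / 2) (v := (1, 0, 0)) hx] <;>
    simp [warpedForm]
  all_goals ring

theorem deriv_sq_mul_south (hg : PullsBackToWarpedForm b θ α g) (hα : IsColatitude b α) {x : ℝ}
    (hx : x ∈ Ioo 0 b) : deriv α x ^ 2 * orthogonalNormSq g (0, 1) (π, π - α x) = 1 := by
  rw [← neg_sq, ← warpedForm_eq_orthogonalNormSq hg hα (y := π / 2) (v := (1, 0, 0)) hx] <;>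
    simp [warpedForm]
  all_goals ring

theorem sin_sq_eq_angular (hg : PullsBackToWarpedForm b θ α g) (hα : IsColatitude b α) {x : ℝ}
    (hx : x ∈ Ioo 0 b) :
    sin (θ x) ^ 2 = sin (α x) ^ 2 * orthogonalNormSq g (0, 1) (α x, 0) := by
  rw [← warpedForm_eq_orthogonalNormSq hg hα (y := 0) (v := (0, 1, 0)) hx] <;>
    simp [warpedForm]

theorem sin_sq_eq_angular_neg (hg : PullsBackToWarpedForm b θ α g) (hα : IsColatitude b α) {x : ℝ}
    (hx : x ∈ Ioo 0 b) :
    sin (θ x) ^ 2 = sin (α x) ^ 2 * orthogonalNormSq g (0, 1) (-α x, 0) := by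
  rw [← neg_sq (sin (α x)),
    ← warpedForm_eq_orthogonalNormSq hg hα (y := π) (v := (0, 1, 0)) hx] <;>
    simp [warpedForm]

theorem contDiff_radial (g : SmoothMetricS2R) (v : ℝ × ℝ) :
    ContDiff ℝ ∞ fun r => orthogonalNormSq g v (r, 0) :=
  (contDiff_orthogonalNormSq g v).comp (contDiff_id.prodMk contDiff_const)

theorem smoothParityOn_of_pos {f : ℝ → ℝ} (hf : ContDiff ℝ ∞ f)
    (h : ∀ r ∈ Ioo 0 π, f (-r) = f r) : SmoothParityOn π 1 f where
  smooth := hf.contDiffOn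
  parity r hr := by
    rw [one_mul]
    rcases lt_trichotomy r 0 with h0 | rfl | h0
    · simpa using (h (-r) ⟨by linarith, by linarith [hr.1]⟩).symm
    · rw [neg_zero]
    · exact h r ⟨h0, hr.2⟩

theorem radial_neg (hb : 0 < b) (hg : PullsBackToWarpedForm b θ α g) (hα : IsColatitude b α)
    {r : ℝ} (hr : r ∈ Ioo 0 π) :
    orthogonalNormSq g (1, 0) (-r, 0) = orthogonalNormSq g (1, 0) (r, 0) := by
  obtain ⟨x, hx, rfl⟩ := hα.exists_eq hb hr
  have h0 := pow_pos (hα.deriv_pos x hx) 2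
  exact mul_left_cancel₀ h0.ne'
    ((deriv_sq_mul_radial_neg hg hα hx).trans (deriv_sq_mul_radial hg hα hx).symm)

theorem angular_neg (hb : 0 < b) (hg : PullsBackToWarpedForm b θ α g) (hα : IsColatitude b α)
    {r : ℝ} (hr : r ∈ Ioo 0 π) :
    orthogonalNormSq g (0, 1) (-r, 0) = orthogonalNormSq g (0, 1) (r, 0) := by
  have h0 := pow_pos (sin_pos_of_pos_of_lt_pi hr.1 hr.2) 2
  obtain ⟨x, hx, rfl⟩ := hα.exists_eq hb hr
  exact mul_left_cancel₀ h0.ne'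
    ((sin_sq_eq_angular_neg hg hα hx).symm.trans (sin_sq_eq_angular hg hα hx))

theorem eq_zero_of_eq_on_Ioo {f h : ℝ → ℝ} (hf : Continuous f) (hh : Continuous h)
    (hfh : ∀ r ∈ Ioo 0 π, f r = h r) : f 0 = h 0 := by
  refine tendsto_nhds_unique (hf.tendsto 0 |>.mono_left nhdsWithin_le_nhds)
    ((hh.tendsto 0 |>.mono_left nhdsWithin_le_nhds).congr' ?_) (l := nhdsWithin 0 (Ioi 0))
  filter_upwards [Ioo_mem_nhdsGT pi_pos] with r hr using (hfh r hr).symm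

/-- The curve `t ↦ orthogonalParam (0, t)` is the meridian of longitude `π / 2`, so its speed at
colatitude `r` equals that of the meridian of longitude `0`; letting `r` tend to `0` gives equality
at the pole. -/
theorem angular_eq_radial_north (hb : 0 < b) (hg : PullsBackToWarpedForm b θ α g)
    (hα : IsColatitude b α) :
    orthogonalNormSq g (0, 1) (0, 0) = orthogonalNormSq g (1, 0) (0, 0) := by
  have hc := fun v => (contDiff_orthogonalNormSq g v).continuous
  refine eq_zero_of_eq_on_Ioo (f := fun t => orthogonalNormSq g (0, 1) (0, t))
    (h := fun r => orthogonalNormSq g (1, 0) (r, 0)) ((hc _).comp (by fun_prop))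
    ((hc _).comp (by fun_prop)) fun r hr => ?_
  obtain ⟨x, hx, rfl⟩ := hα.exists_eq hb hr
  have h0 := pow_pos (hα.deriv_pos x hx) 2
  exact mul_left_cancel₀ h0.ne'
    ((deriv_sq_mul_north hg hα hx).trans (deriv_sq_mul_radial hg hα hx).symm)

theorem angular_eq_radial_south (hb : 0 < b) (hg : PullsBackToWarpedForm b θ α g)
    (hα : IsColatitude b α) :
    orthogonalNormSq g (0, 1) (π, 0) = orthogonalNormSq g (1, 0) (π, 0) := by
  have hc := fun v => (contDiff_orthogonalNormSq g v).continuous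
  have h := eq_zero_of_eq_on_Ioo (f := fun t => orthogonalNormSq g (0, 1) (π, t))
    (h := fun r => orthogonalNormSq g (1, 0) (π - r, 0)) ((hc _).comp (by fun_prop))
    ((hc _).comp (by fun_prop)) fun r hr => ?_
  · simpa using h
  obtain ⟨x, hx, hxr⟩ := hα.exists_eq hb (r := π - r) ⟨by linarith [hr.2], by linarith [hr.1]⟩
  have h0 := pow_pos (hα.deriv_pos x hx) 2
  have h1 := deriv_sq_mul_south hg hα hx
  have h2 := deriv_sq_mul_radial hg hα hx
  rw [hxr] at h1 h2
  rw [sub_sub_cancel] at h1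
  exact mul_left_cancel₀ h0.ne' (h1.trans h2.symm)

/-- Evenness about `0` together with the period `2π` gives evenness about `π`, which is the symmetry
needed at the south pole. -/
theorem reflect_neg (f : ℝ → ℝ) (hper : ∀ r, f (r + 2 * π) = f r)
    (hf : ∀ r ∈ Ioo 0 π, f (-r) = f r) : ∀ r ∈ Ioo 0 π, f (π - -r) = f (π - r) := by
  intro r hr
  rw [← hf (π - r) ⟨by linarith [hr.2], by linarith [hr.1]⟩, ← hper (-(π - r))]
  congr 1
  ring

end MetricComponents

theorem derivatives_of_pullsBackToWarpedForm {b : ℝ} (hb : 0 < b) {θ α : ℝ → ℝ}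
    (hθ : ContDiffOn ℝ ∞ θ (Icc 0 b)) (hθmem : ∀ x ∈ Ioo 0 b, θ x ∈ Ioo 0 (π / 2))
    (hα : IsColatitude b α) {g : SmoothMetricS2R} (hg : PullsBackToWarpedForm b θ α g) :
    (derivWithin θ (Icc 0 b) 0 = 1 ∧
      ∀ k : ℕ, iteratedDerivWithin (2 * k) θ (Icc 0 b) 0 = 0) ∧
    (derivWithin (fun x => θ (b - x)) (Icc 0 b) 0 = 1 ∧
      ∀ k : ℕ, iteratedDerivWithin (2 * k) (fun x => θ (b - x)) (Icc 0 b) 0 = 0) := by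
  constructor
  · exact endpoint_derivatives hb hθ hθmem (hα.tendsto_left hb)
      (fun x hx => (hα.hasDerivAt hx).differentiableAt) hα.deriv_pos (fun x hx => hα.mem_Ioo hx)
      (smoothParityOn_of_pos (contDiff_radial g (1, 0)) fun r hr => radial_neg hb hg hα hr)
      (smoothParityOn_of_pos (contDiff_radial g (0, 1)) fun r hr => angular_neg hb hg hα hr)
      (fun r _ => orthogonalNormSq_radial_pos g r) (fun r _ => orthogonalNormSq_angular_pos g r)
      (angular_eq_radial_north hb hg hα) (fun x hx => deriv_sq_mul_radial hg hα hx)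
      (fun x hx => sin_sq_eq_angular hg hα hx)
  · have hmem : ∀ x ∈ Ioo 0 b, b - x ∈ Ioo 0 b := fun x hx =>
      ⟨by linarith [hx.2], by linarith [hx.1]⟩
    have hα' := hα.reflect
    have hrefl : ContDiff ℝ ∞ fun r : ℝ => π - r := contDiff_const.sub contDiff_id
    refine endpoint_derivatives hb (α := fun x => π - α (b - x))
      (e := fun r => orthogonalNormSq g (1, 0) (π - r, 0))
      (m := fun r => orthogonalNormSq g (0, 1) (π - r, 0))
      (hθ.comp (contDiff_const.sub contDiff_id).contDiffOn fun x hx =>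
        ⟨by simpa using hx.2, by simpa using hx.1⟩)
      (fun x hx => hθmem _ (hmem x hx)) (hα'.tendsto_left hb)
      (fun x hx => (hα'.hasDerivAt hx).differentiableAt) hα'.deriv_pos
      (fun x hx => hα'.mem_Ioo hx)
      (smoothParityOn_of_pos ((contDiff_radial g (1, 0)).comp hrefl)
        (reflect_neg (fun r => orthogonalNormSq g (1, 0) (r, 0))
          (fun r => orthogonalNormSq_periodic g _ r 0) fun r hr => radial_neg hb hg hα hr))
      (smoothParityOn_of_pos ((contDiff_radial g (0, 1)).comp hrefl)
        (reflect_neg (fun r => orthogonalNormSq g (0, 1) (r, 0))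
          (fun r => orthogonalNormSq_periodic g _ r 0) fun r hr => angular_neg hb hg hα hr))
      (fun r _ => orthogonalNormSq_radial_pos g _) (fun r _ => orthogonalNormSq_angular_pos g _)
      (by simpa using angular_eq_radial_south hb hg hα) (fun x hx => ?_) (fun x hx => ?_)
    · rw [deriv_const_sub, deriv_comp_const_sub, neg_neg, sub_sub_cancel]
      exact deriv_sq_mul_radial hg hα (hmem x hx)
    · rw [sub_sub_cancel, sin_pi_sub]
      exact sin_sq_eq_angular hg hα (hmem x hx)

/-! ### Transfer of derivatives from `b` to `0` -/

section Reflection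

open scoped Pointwise

theorem vadd_neg_Icc (b : ℝ) : b +ᵥ -Icc 0 b = Icc 0 b := by
  ext x
  rw [Set.mem_vadd_set_iff_neg_vadd_mem]
  simp [and_comm]

theorem iteratedDerivWithin_reflect {b : ℝ} (θ : ℝ → ℝ) (k : ℕ) :
    iteratedDerivWithin (2 * k) (fun x => θ (b - x)) (Icc 0 b) 0 =
      iteratedDerivWithin (2 * k) θ (Icc 0 b) b := by
  rw [iteratedDerivWithin_comp_const_sub, vadd_neg_Icc]
  simp

theorem derivWithin_reflect {b : ℝ} (θ : ℝ → ℝ) :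
    derivWithin (fun x => θ (b - x)) (Icc 0 b) 0 = -derivWithin θ (Icc 0 b) b := by
  rw [derivWithin_comp_const_sub, vadd_neg_Icc, sub_zero]

end Reflection
end

theorem proposition7 (b : ℝ) (hb : 0 < b) (θ : ℝ → ℝ)
    (hsmooth : ContDiffOn ℝ ∞ θ (Icc 0 b))
    (hnonneg : ∀ x ∈ Icc 0 b, 0 ≤ θ x)
    (hzero : {x ∈ Icc 0 b | θ x = 0} = {0, b})
    (hpi : {x ∈ Icc 0 b | θ x = π / 2} = ∅) :
    DefinesSmoothMetricOnS2R b θ ↔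
      (derivWithin θ (Icc 0 b) 0 = 1 ∧ -derivWithin θ (Icc 0 b) b = 1) ∧
      ∀ k : ℕ, iteratedDerivWithin (2 * k) θ (Icc 0 b) 0 = 0 ∧
        iteratedDerivWithin (2 * k) θ (Icc 0 b) b = 0 := by
  have hθ0 : θ 0 = 0 := by
    have h : (0 : ℝ) ∈ {x ∈ Icc 0 b | θ x = 0} := by rw [hzero]; simp
    exact h.2
  -- `θ` starts at `0` and never takes the value `π / 2`, so it cannot pass it; this makes `arcsin
  -- (sin θ) = θ` and `cos θ > 0` available.
  have hlt : ∀ x ∈ Icc 0 b, θ x < π / 2 := by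
    intro x hx
    by_contra! h
    have hsub : Icc 0 x ⊆ Icc 0 b := Icc_subset_Icc_right hx.2
    obtain ⟨y, hy, hy'⟩ := intermediate_value_Icc hx.1 (hsmooth.continuousOn.mono hsub)
      (show π / 2 ∈ Icc (θ 0) (θ x) from ⟨by rw [hθ0]; positivity, h⟩)
    have : y ∈ {x ∈ Icc 0 b | θ x = π / 2} := ⟨hsub hy, hy'⟩
    rw [hpi] at this
    exact this
  have hmem : ∀ x ∈ Ioo 0 b, θ x ∈ Ioo 0 (π / 2) := by
    intro x hx
    have hx' := Ioo_subset_Icc_self hx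
    refine ⟨lt_of_le_of_ne (hnonneg x hx') fun h => ?_, hlt x hx'⟩
    have : x ∈ ({0, b} : Set ℝ) := by rw [← hzero]; exact ⟨hx', h.symm⟩
    rcases this with rfl | rfl
    · exact lt_irrefl _ hx.1
    · exact lt_irrefl _ hx.2
  -- Conditions at `b` become conditions at `0` on `x ↦ θ (b - x)`: the slope changes sign, even
  -- orders do not.
  rw [← derivWithin_reflect θ]
  simp only [← iteratedDerivWithin_reflect θ]
  constructor
  · rintro ⟨α, hα, g, hg⟩
    obtain ⟨h0, h1⟩ := derivatives_of_pullsBackToWarpedForm hb hsmooth hmem hα hg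
    exact ⟨⟨h0.1, h1.1⟩, fun k => ⟨h0.2 k, h1.2 k⟩⟩
  · rintro ⟨⟨h0, h1⟩, h⟩
    obtain ⟨A, B, C, ⟨hA, hB, hC⟩, hABC⟩ := exists_coefficients hb hsmooth h0
      (fun k => (h k).1) h1 (fun k => (h k).2)
    refine definesSmoothMetricOnS2R_of_coefficients hb (fun x hx => ?_) (fun x hx => ?_)
      hA hB hC hABC
    · have := hmem x hx
      exact (sin_pos_of_pos_of_lt_pi this.1 (by linarith [this.2, pi_pos])).ne'
    · exact (cos_pos_of_mem_Ioo ⟨by linarith [hnonneg x hx, pi_pos], hlt x hx⟩).ne'
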